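/- Consider the system $x_0=0$, $x_{t+1}=Ax_t+Bu_t+w_t$, $y_t=u_t^\top Cx_t+z_t$ with $A\in\mathbb R^{n\times n}$, $B\in\mathbb R^{n\times p}$, $C\in\mathbb R^{p\times n}$, observed through $\{(u_t,y_t)\}_{t=0}^T$. $\|\cdot\|$ is the spectral norm, $\|\cdot\|_F$ the Frobenius norm and $\rho(A)$ the spectral radius. Assume: (i) $\rho(A)<1$; fix $\rho\in(\rho(A),1)$ and let $\phi(A,\rho)=\sup_{k\ge0}\|A^k\|/\rho^k$. (ii) $w_0,\dots,w_T$ are i.i.d. with $\mathbb E w_t=0$, $\mathbb E[w_tw_t^\top]=\Sigma_w$ (finite), and $z_0,\dots,z_T$ are i.i.d. with $\mathbb E z_t=0$, $\mathbb E z_t^2=\sigma_z^2<\infty$. (iii) $u_0,\dots,u_T$ are i.i.d. with $\mathbb E u_t=0$, $\mathbb E[u_tu_t^\top]=I_p$ and $\|u_t\|_2\le\beta$ almost surely, where $\beta>0$; the processes $(u_t)$, $(w_t)$, $(z_t)$ are mutually independent. Let $L\ge1$, $\delta\in(0,1)$, $\bar u_t=(u_t^\top,\dots,u_{t-L+1}^\top)^\top$,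 $G=[\,CB\;\;CAB\;\cdots\;CA^{L-1}B\,]\in\mathbb R^{p\times pL}$, $F=[\,C\;\;CA\;\cdots\;CA^{L-1}\,]$, $\Gamma_w^\infty=\sum_{i\ge0}A^i\Sigma_w(A^i)^\top$, $K=\max\{\|B\|,\|C\|\}$, $$\sigma_w^2=\|\Sigma_w\|\,\|F\|_F^2\Big(1+\frac{\phi(A,\rho)\rho^L}{1-\rho}\Big),\qquad \sigma_e^2=\|\Gamma_w^\infty\|\,\|CA^L\|^2\frac{\phi(A,\rho)}{1-\rho},\qquad \Xi=\sigma_z^2+\sigma_w^2\beta^2L+\sigma_e^2\beta^2,$$ and assume $\Xi>0$. There are absolute constants $c_1,c_2>0$ such that the following holds. If $$T-L\ \ge\ c_1\,\beta^4L(L+1)\Big(\log\frac{2(L+1)}{\delta}+p^2L\Big)$$ and $$L\ \ge\ \frac1{\log(\rho^{-1})}\left(\frac12\log\frac{(T-L)\,\delta}{p^2L\,\Xi}+\log\frac{2\beta^2K^2\phi(A,\rho)}{1-\rho}\right)$$ (the last condition being void when $K=0$), then with probability at least $1-\delta$ every solution $$\hat G\in\arg\min_{M\in\mathbb R^{p\times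 pL}}\ \frac1{2(T-L)}\sum_{t=L+1}^{T}\big(y_t-u_t^\top M\bar u_{t-1}\big)^2$$ satisfies $$\|\hat G-G\|_F\ \le\ c_2\sqrt{\frac{p^2L\,(\sigma_z^2+\sigma_w^2\beta^2L+\sigma_e^2\beta^2)}{\delta\,(T-L)}}\,.$$ -/

import Mathlib

open MeasureTheory ProbabilityTheory
open scoped Matrix

noncomputable section

namespace BilinearObs

/-- Spectral norm of a real matrix (operator norm between Euclidean spaces). -/
def specNorm {ι κ : Type} [Fintype ι] [Fintype κ] [DecidableEq κ] (M : Matrix ι κ ℝ) : ℝ :=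
  @norm _ (Matrix.instL2OpNormedAddCommGroup (m := ι) (n := κ) (𝕜 := ℝ)).toNorm M

/-- Frobenius norm of a real matrix. -/
def frobNorm {ι κ : Type} [Fintype ι] [Fintype κ] (M : Matrix ι κ ℝ) : ℝ :=
  @norm _ (Matrix.frobeniusNormedAddCommGroup (m := ι) (n := κ) (α := ℝ)).toNorm M

/-- Spectral radius of a real square matrix: the largest modulus of a complex eigenvalue. -/
def specRadius {n : ℕ} (A : Matrix (Fin n) (Fin n) ℝ) : ENNReal :=
  spectralRadius ℂ (A.map (algebraMap ℝ ℂ))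

/-- The transient constant `φ(A, ρ) = sup_k ‖A ^ k‖ / ρ ^ k`. -/
def transient {n : ℕ} (A : Matrix (Fin n) (Fin n) ℝ) (ρ : ℝ) : ℝ :=
  ⨆ k : ℕ, specNorm (A ^ k) / ρ ^ k

/-- The infinite time Gramian `∑_{i ≥ 0} A ^ i Σ_w (A ^ i)ᵀ` of the process noise. -/
def gramian {n : ℕ} (A Sw : Matrix (Fin n) (Fin n) ℝ) : Matrix (Fin n) (Fin n) ℝ :=
  ∑' i : ℕ, A ^ i * Sw * (A ^ i)ᵀ

/-- The state: `x_0 = 0`, `x_{t+1} = A x_t + B u_t + w_t`. -/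
def state {n p : ℕ} (A : Matrix (Fin n) (Fin n) ℝ) (B : Matrix (Fin n) (Fin p) ℝ)
    (u : ℕ → EuclideanSpace ℝ (Fin p)) (w : ℕ → EuclideanSpace ℝ (Fin n)) : ℕ → (Fin n → ℝ)
  | 0 => 0
  | t + 1 => A *ᵥ state A B u w t + B *ᵥ (u t).ofLp + (w t).ofLp

/-- The bilinear observation: `y_t = u_tᵀ C x_t + z_t`. -/
def output {n p : ℕ} (A : Matrix (Fin n) (Fin n) ℝ) (B : Matrix (Fin n) (Fin p) ℝ)
    (C : Matrix (Fin p) (Fin n) ℝ) (u : ℕ → EuclideanSpace ℝ (Fin p))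
    (w : ℕ → EuclideanSpace ℝ (Fin n)) (z : ℕ → ℝ) (t : ℕ) : ℝ :=
  (u t).ofLp ⬝ᵥ (C *ᵥ state A B u w t) + z t

/-- The Markov parameter matrix `G = [CB, CAB, …, CA^{L-1}B]`; columns are indexed by
(block, column within the block). -/
def markov {n p : ℕ} (L : ℕ) (A : Matrix (Fin n) (Fin n) ℝ) (B : Matrix (Fin n) (Fin p) ℝ)
    (C : Matrix (Fin p) (Fin n) ℝ) : Matrix (Fin p) (Fin L × Fin p) ℝ :=
  Matrix.of fun i lj => (C * A ^ (lj.1 : ℕ) * B) i lj.2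

/-- The matrix `F = [C, CA, …, CA^{L-1}]`. -/
def noiseMarkov {n p : ℕ} (L : ℕ) (A : Matrix (Fin n) (Fin n) ℝ)
    (C : Matrix (Fin p) (Fin n) ℝ) : Matrix (Fin p) (Fin L × Fin n) ℝ :=
  Matrix.of fun i lj => (C * A ^ (lj.1 : ℕ)) i lj.2

/-- The stacked inputs `ū_t = (u_t, u_{t-1}, …, u_{t-L+1})`, used only for `t ≥ L`. -/
def lagged {p : ℕ} (L : ℕ) (u : ℕ → EuclideanSpace ℝ (Fin p)) (t : ℕ) : Fin L × Fin p → ℝ :=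
  fun lj => (u (t - lj.1)).ofLp lj.2

/-- The least-squares objective
`1 / (2 (T - L)) ∑_{t = L+1}^{T} (y_t - u_tᵀ M ū_{t-1})²`. -/
def lsLoss {p : ℕ} (L T : ℕ) (u : ℕ → EuclideanSpace ℝ (Fin p)) (y : ℕ → ℝ)
    (M : Matrix (Fin p) (Fin L × Fin p) ℝ) : ℝ :=
  1 / (2 * ((T : ℝ) - (L : ℝ))) *
    ∑ t ∈ Finset.Icc (L + 1) T, (y t - (u t).ofLp ⬝ᵥ (M *ᵥ lagged L u (t - 1))) ^ 2

/-- `M` is a solution of the least-squares problem. -/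
def IsLeastSquares {p : ℕ} (L T : ℕ) (u : ℕ → EuclideanSpace ℝ (Fin p)) (y : ℕ → ℝ)
    (M : Matrix (Fin p) (Fin L × Fin p) ℝ) : Prop :=
  ∀ M' : Matrix (Fin p) (Fin L × Fin p) ℝ, lsLoss L T u y M ≤ lsLoss L T u y M'

/-- `σ_w² = ‖Σ_w‖ ‖F‖_F² (1 + φ(A, ρ) ρ^L / (1 - ρ))`. -/
def sigmaWSq {n p : ℕ} (L : ℕ) (A : Matrix (Fin n) (Fin n) ℝ) (C : Matrix (Fin p) (Fin n) ℝ)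
    (Sw : Matrix (Fin n) (Fin n) ℝ) (ρ : ℝ) : ℝ :=
  specNorm Sw * frobNorm (noiseMarkov L A C) ^ 2 * (1 + transient A ρ * ρ ^ L / (1 - ρ))

/-- `σ_e² = ‖Γ_w^∞‖ ‖C A^L‖² φ(A, ρ) / (1 - ρ)`. -/
def sigmaESq {n p : ℕ} (L : ℕ) (A : Matrix (Fin n) (Fin n) ℝ) (C : Matrix (Fin p) (Fin n) ℝ)
    (Sw : Matrix (Fin n) (Fin n) ℝ) (ρ : ℝ) : ℝ :=
  specNorm (gramian A Sw) * specNorm (C * A ^ L) ^ 2 * (transient A ρ / (1 - ρ))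

/-- `σ_z² + σ_w² β² L + σ_e² β²`. -/
def noiseLevel {n p : ℕ} (L : ℕ) (A : Matrix (Fin n) (Fin n) ℝ) (C : Matrix (Fin p) (Fin n) ℝ)
    (Sw : Matrix (Fin n) (Fin n) ℝ) (σz ρ β : ℝ) : ℝ :=
  σz ^ 2 + sigmaWSq L A C Sw ρ * β ^ 2 * L + sigmaESq L A C Sw ρ * β ^ 2

/-- `X_0, …, X_T` are independent and identically distributed random variables. -/
structure IsIID {Ω E : Type*} [MeasurableSpace Ω] [MeasurableSpace E] (μ : Measure Ω) (T : ℕ)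
    (X : ℕ → Ω → E) : Prop where
  measurable : ∀ t ≤ T, Measurable (X t)
  indep : iIndepFun (fun t : Fin (T + 1) => X t) μ
  identDistrib : ∀ t ≤ T, IdentDistrib (X t) (X 0) μ μ

/-- The inputs `u_0, …, u_T` are i.i.d., have mean zero and identity covariance, and are bounded
by `β` in Euclidean norm. -/
structure BoundedInputs {Ω : Type*} [MeasurableSpace Ω] (μ : Measure Ω) {p : ℕ} (T : ℕ)
    (u : ℕ → Ω → EuclideanSpace ℝ (Fin p)) (β : ℝ) : Prop where
  iid : IsIID μ T u
  mean : ∀ t ≤ T, ∫ ω, u t ω ∂μ = 0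
  isotropic : ∀ t ≤ T, ∀ i j, ∫ ω, u t ω i * u t ω j ∂μ = (1 : Matrix (Fin p) (Fin p) ℝ) i j
  bounded : ∀ t ≤ T, ∀ᵐ ω ∂μ, ‖u t ω‖ ≤ β

/-- The process noise `w_0, …, w_T` and the measurement noise `z_0, …, z_T` are each i.i.d. and
centered, with finite second moments `E[w wᵀ] = Σ_w` and `E[z²] = σ_z²`. -/
structure NoiseAssumption {Ω : Type*} [MeasurableSpace Ω] (μ : Measure Ω) {n : ℕ} (T : ℕ)
    (w : ℕ → Ω → EuclideanSpace ℝ (Fin n)) (z : ℕ → Ω → ℝ)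
    (Sw : Matrix (Fin n) (Fin n) ℝ) (σz : ℝ) : Prop where
  iid_w : IsIID μ T w
  iid_z : IsIID μ T z
  memLp_w : ∀ t ≤ T, MemLp (w t) 2 μ
  memLp_z : ∀ t ≤ T, MemLp (z t) 2 μ
  mean_w : ∀ t ≤ T, ∫ ω, w t ω ∂μ = 0
  mean_z : ∀ t ≤ T, ∫ ω, z t ω ∂μ = 0
  cov_w : ∀ t ≤ T, ∀ i j, ∫ ω, w t ω i * w t ω j ∂μ = Sw i j
  var_z : ∀ t ≤ T, ∫ ω, z t ω ^ 2 ∂μ = σz ^ 2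

/-- The three processes `(u_t)`, `(w_t)`, `(z_t)`, `0 ≤ t ≤ T`, are mutually independent. -/
structure IndepProcesses {Ω : Type*} [MeasurableSpace Ω] (μ : Measure Ω) {n p : ℕ} (T : ℕ)
    (u : ℕ → Ω → EuclideanSpace ℝ (Fin p)) (w : ℕ → Ω → EuclideanSpace ℝ (Fin n))
    (z : ℕ → Ω → ℝ) : Prop where
  input_noise : IndepFun (fun ω (t : Fin (T + 1)) => u t ω)
    (fun ω => ((fun t : Fin (T + 1) => w t ω), (fun t : Fin (T + 1) => z t ω))) μ
  noise_noise : IndepFun (fun ω (t : Fin (T + 1)) => w t ω)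
    (fun ω (t : Fin (T + 1)) => z t ω) μ

end BilinearObs

end

/-! Write N = T - L and X_t = u_t ⊗ ū_{t-1} (`feature`). Unrolling the state turns the bilinear
observation into a linear regression y_t = ⟪vec G, X_t⟫ + a_t + b_t (`output_eq`). Here a_t = z_t +
⟪h_t, u_t⟫ carries the measurement noise and the filtered process noise h_t (`noiseState`), and b_t
(`tailBias`) carries the inputs more than L steps old. Comparing the loss at a minimiser with the
loss at G bounds the error by ‖∑ a_t X_t‖ / N and the root mean square of b_t, as soon as ∑ ⟪v,
X_t⟫² ≥ (N/4)‖v‖² for all v (`norm_sq_le_of_leastSquares`).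

Excitation. The X_t are isotropic, and ⟪v, X_t⟫² ≤ β⁴L on the unit ball, so the variance of ⟪v,
X_t⟫² is also at most β⁴L. Since X_t only sees the window u_{t-L}, …, u_t, times in one residue
class mod L + 1 give independent terms. A Chernoff bound, averaged over the classes by convexity of
exp, handles a fixed v (`measure_sum_ge_le`). A union over a net of at most 17^(p²L) points handles
all v (`measure_not_excited_le`).

Noise. The noise has only second moments, so Chebyshev's inequality is used; hence the factor 1/δ
under the root. With the noise frozen, the terms a_t X_t at different times are orthogonal, because
the oldest input of the earlier term occurs only once and is centred. This gives E‖∑ a_t X_t‖² ≤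
2p²LΞN (`RegularInputs.integral_norm_sq_sum_le`, `lintegral_noiseCorr_le`).

Bias. b_t is a geometric tail of order ρ^L, and the lower bound on L is exactly what makes b_t² at
most p²LΞ/(4δN) (`tailBias_sq_le`). -/

namespace BilinearObs

open scoped RealInnerProductSpace

/-! ### Nets of the unit ball -/

section Net

variable {E : Type*} [NormedAddCommGroup E] [NormedSpace ℝ E] [FiniteDimensional ℝ E]

/-- Volume comparison: the balls of radius 1/16 around the points are disjoint and lie in the ball
of radius 17/16. -/
lemma card_le_of_separated_eighth (s : Finset E) (hs : ∀ c ∈ s, ‖c‖ ≤ 1)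
    (h : ∀ c ∈ s, ∀ d ∈ s, c ≠ d → 1 / 8 ≤ ‖c - d‖) :
    s.card ≤ 17 ^ Module.finrank ℝ E := by
  borelize E
  let μ : Measure E := Measure.addHaar
  have D : Set.Pairwise (s : Set E) (Function.onFun Disjoint fun c => Metric.ball (c : E) (1 / 16)) := by
    rintro c hc d hd hcd
    apply Metric.ball_disjoint_ball
    rw [dist_eq_norm]
    linarith [h c hc d hd hcd]
  have A_subset : (⋃ c ∈ s, Metric.ball (c : E) (1 / 16)) ⊆ Metric.ball (0 : E) (17 / 16) := by
    refine Set.iUnion₂_subset fun x hx => Metric.ball_subset_ball' ?_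
    rw [dist_zero_right]
    linarith [hs x hx]
  have I : (s.card : ENNReal) * ENNReal.ofReal ((1 / 16 : ℝ) ^ Module.finrank ℝ E) *
        μ (Metric.ball 0 1) ≤
      ENNReal.ofReal ((17 / 16 : ℝ) ^ Module.finrank ℝ E) * μ (Metric.ball 0 1) := by
    calc
      _ = μ (⋃ c ∈ s, Metric.ball (c : E) (1 / 16)) := by
        rw [measure_biUnion_finset D fun c _ => measurableSet_ball]
        simp only [μ.addHaar_ball_of_pos _ (by norm_num : (0 : ℝ) < 1 / 16)]
        simp only [Finset.sum_const, nsmul_eq_mul, mul_assoc]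
      _ ≤ μ (Metric.ball (0 : E) (17 / 16)) := measure_mono A_subset
      _ = _ := by
        simp only [μ.addHaar_ball_of_pos _ (by norm_num : (0 : ℝ) < 17 / 16)]
  have J := (ENNReal.mul_le_mul_iff_left (Metric.measure_ball_pos _ _ zero_lt_one).ne'
    measure_ball_lt_top.ne).1 I
  have K : (s.card : ℝ) ≤ (17 : ℝ) ^ Module.finrank ℝ E := by
    have := ENNReal.toReal_le_of_le_ofReal (by positivity) J
    simpa [div_eq_mul_inv, mul_pow] using this
  exact mod_cast K

/-- A separated set of maximal cardinality is a net, since an uncovered point could be added to it.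
-/
lemma exists_eighth_net : ∃ s : Finset E, (∀ c ∈ s, ‖c‖ ≤ 1) ∧
    s.card ≤ 17 ^ Module.finrank ℝ E ∧ ∀ x : E, ‖x‖ ≤ 1 → ∃ c ∈ s, ‖x - c‖ ≤ 1 / 8 := by
  classical
  let S : Set ℕ := {k | ∃ s : Finset E, s.card = k ∧ (∀ c ∈ s, ‖c‖ ≤ 1) ∧
    ∀ c ∈ s, ∀ d ∈ s, c ≠ d → 1 / 8 ≤ ‖c - d‖}
  have hb : BddAbove S := ⟨17 ^ Module.finrank ℝ E, by
    rintro _ ⟨s, rfl, h1, h2⟩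
    exact card_le_of_separated_eighth s h1 h2⟩
  have hne : S.Nonempty := ⟨0, ∅, by simp⟩
  obtain ⟨s, hc, h1, h2⟩ := Nat.sSup_mem hne hb
  refine ⟨s, h1, card_le_of_separated_eighth s h1 h2, fun x hx => ?_⟩
  by_contra! hcon
  have hxs : x ∉ s := fun hxs => by
    have := hcon x hxs
    simp at this
    linarith
  have hmem : s.card + 1 ∈ S := by
    refine ⟨insert x s, Finset.card_insert_of_notMem hxs, ?_, ?_⟩
    · intro c hc
      rcases Finset.mem_insert.1 hc with rfl | hc
      · exact hx
      · exact h1 c hc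
    · intro c hc d hd hcd
      rcases Finset.mem_insert.1 hc with hcx | hc' <;>
        rcases Finset.mem_insert.1 hd with hdx | hd'
      · exact absurd (hcx.trans hdx.symm) hcd
      · rw [hcx]
        exact (hcon d hd').le
      · rw [hdx, norm_sub_rev]
        exact (hcon c hc').le
      · exact h2 c hc' d hd' hcd
  have := le_csSup hb hmem
  omega

end Net

/-! ### Deterministic analysis of least squares -/

section LeastSquares

variable {V τ : Type*} [NormedAddCommGroup V] [InnerProductSpace ℝ V]

/-- The net first bounds the operator norm from above. That bound then controls the loss in passing
from a unit vector to its nearest net point, which yields the lower bound. -/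
lemma le_sum_inner_sq_of_net [FiniteDimensional ℝ V] (J : Finset τ) (X : τ → V) {N : ℝ}
    (hN : 0 ≤ N) (s : Finset V) (hs : ∀ c ∈ s, ‖c‖ ≤ 1)
    (hnet : ∀ x : V, ‖x‖ ≤ 1 → ∃ c ∈ s, ‖x - c‖ ≤ 1 / 8)
    (h : ∀ c ∈ s, |∑ t ∈ J, ⟪c, X t⟫ ^ 2 - N * ‖c‖ ^ 2| ≤ N / 4) (v : V) :
    N / 4 * ‖v‖ ^ 2 ≤ ∑ t ∈ J, ⟪v, X t⟫ ^ 2 := by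
  -- The quadratic form is ‖Φ v‖² for the analysis operator Φ v = (⟪v, X_t⟫)_t.
  let Φl : V →ₗ[ℝ] EuclideanSpace ℝ J :=
    { toFun := fun v => WithLp.toLp 2 fun t : J => ⟪v, X t⟫
      map_add' := fun x y => by ext t; simp [inner_add_left]
      map_smul' := fun c x => by ext t; simp [inner_smul_left] }
  let Φ : V →L[ℝ] EuclideanSpace ℝ J := LinearMap.toContinuousLinearMap Φl
  have hΦ : ∀ v, ‖Φ v‖ ^ 2 = ∑ t ∈ J, ⟪v, X t⟫ ^ 2 := fun v => by
    rw [EuclideanSpace.real_norm_sq_eq, ← Finset.sum_coe_sort J]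
    rfl
  obtain ⟨R, hR, rfl⟩ : ∃ R : ℝ, 0 ≤ R ∧ N = R ^ 2 :=
    ⟨√N, Real.sqrt_nonneg _, (Real.sq_sqrt hN).symm⟩
  simp_rw [← hΦ] at h ⊢
  have hup : ∀ c ∈ s, ‖Φ c‖ ≤ 9 / 8 * R := fun c hc => by
    have h1 := (abs_le.1 (h c hc)).2
    have h2 : R ^ 2 * ‖c‖ ^ 2 ≤ R ^ 2 * 1 :=
      mul_le_mul_of_nonneg_left (pow_le_one₀ (norm_nonneg _) (hs c hc)) (by positivity)
    refine le_of_sq_le_sq ?_ (by positivity)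
    nlinarith [sq_nonneg R]
  -- Self-bounding: ‖Φ‖ reappears on the right with factor 1/8 and is absorbed.
  have hM : ‖Φ‖ ≤ 9 / 7 * R := by
    have : ‖Φ‖ ≤ 9 / 8 * R + ‖Φ‖ / 8 := by
      refine ContinuousLinearMap.opNorm_le_of_unit_norm (by positivity) fun x hx => ?_
      obtain ⟨c, hc, hxc⟩ := hnet x hx.le
      have h1 : ‖Φ x‖ ≤ ‖Φ c‖ + ‖Φ (x - c)‖ := by
        have := norm_add_le (Φ c) (Φ (x - c))
        rwa [← map_add, add_sub_cancel] at this
      have h2 := Φ.le_opNorm (x - c)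
      have h3 := mul_le_mul_of_nonneg_left hxc (norm_nonneg Φ)
      linarith [hup c hc]
    linarith
  have hunit : ∀ x : V, ‖x‖ = 1 → R / 2 ≤ ‖Φ x‖ := fun x hx => by
    obtain ⟨c, hc, hxc⟩ := hnet x hx.le
    have h1 : ‖Φ c‖ ≤ ‖Φ x‖ + ‖Φ (x - c)‖ := by
      have := norm_sub_le (Φ x) (Φ (x - c))
      rwa [← map_sub, sub_sub_cancel] at this
    have h2 := Φ.le_opNorm (x - c)
    have h3 := mul_le_mul_of_nonneg_left hxc (norm_nonneg Φ)
    have h4 : 7 / 8 ≤ ‖c‖ := by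
      have := norm_sub_norm_le x c
      linarith
    have h5 : 57 / 80 * R ≤ ‖Φ c‖ := by
      refine le_of_sq_le_sq ?_ (norm_nonneg _)
      have h6 := (abs_le.1 (h c hc)).1
      have h7 : R ^ 2 * (7 / 8) ^ 2 ≤ R ^ 2 * ‖c‖ ^ 2 := by gcongr
      nlinarith [sq_nonneg R]
    linarith
  by_cases hv : v = 0
  · simp [hv]
  have hv' : 0 < ‖v‖ := norm_pos_iff.2 hv
  have h1 := hunit (‖v‖⁻¹ • v) (by rw [norm_smul, norm_inv, norm_norm]; field_simp)
  rw [map_smul, norm_smul, norm_inv, norm_norm, inv_mul_eq_div, le_div_iff₀ hv'] at h1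
  calc R ^ 2 / 4 * ‖v‖ ^ 2 = (R / 2 * ‖v‖) ^ 2 := by ring
    _ ≤ ‖Φ v‖ ^ 2 := by gcongr

/-- Expanding optimality gives Q ≤ 2⟪D, S⟫ + 2∑ b⟪D, X⟫ with Q = ∑⟪D, X⟫². Cauchy–Schwarz handles
the first term. Half of Q absorbs the second, so only a lower bound on Q is ever needed. -/
lemma norm_sq_le_of_leastSquares (J : Finset τ) (X : τ → V) (a b : τ → ℝ) (D : V) {N q : ℝ}
    (hN : 0 < N) (hlow : N / 4 * ‖D‖ ^ 2 ≤ ∑ t ∈ J, ⟪D, X t⟫ ^ 2)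
    (hopt : ∑ t ∈ J, (a t + b t - ⟪D, X t⟫) ^ 2 ≤ ∑ t ∈ J, (a t + b t) ^ 2)
    (hb : ∑ t ∈ J, b t ^ 2 ≤ N * q) :
    ‖D‖ ^ 2 ≤ 256 * (‖∑ t ∈ J, a t • X t‖ ^ 2 / N ^ 2) + 32 * q := by
  set S := ∑ t ∈ J, a t • X t with hS
  set Q := ∑ t ∈ J, ⟪D, X t⟫ ^ 2 with hQ
  have h1 : ∑ t ∈ J, a t * ⟪D, X t⟫ = ⟪D, S⟫ := by
    simp [hS, inner_sum, inner_smul_right]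
  have h2 : Q ≤ 2 * ⟪D, S⟫ + 2 * ∑ t ∈ J, b t * ⟪D, X t⟫ := by
    rw [← h1]
    have : ∑ t ∈ J, (a t + b t - ⟪D, X t⟫) ^ 2 = ∑ t ∈ J, (a t + b t) ^ 2 -
        2 * ∑ t ∈ J, a t * ⟪D, X t⟫ - 2 * ∑ t ∈ J, b t * ⟪D, X t⟫ + Q := by
      rw [hQ, Finset.mul_sum, Finset.mul_sum, ← Finset.sum_sub_distrib, ← Finset.sum_sub_distrib,
        ← Finset.sum_add_distrib]
      exact Finset.sum_congr rfl fun t _ => by ring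
    linarith
  have h3 : 2 * ∑ t ∈ J, b t * ⟪D, X t⟫ ≤ 2 * ∑ t ∈ J, b t ^ 2 + Q / 2 := by
    rw [hQ, Finset.mul_sum, Finset.mul_sum, Finset.sum_div, ← Finset.sum_add_distrib]
    exact Finset.sum_le_sum fun t _ => by nlinarith [sq_nonneg (2 * b t - ⟪D, X t⟫)]
  have h4 : ⟪D, S⟫ ≤ ‖D‖ * ‖S‖ := real_inner_le_norm D S
  have h5 : N / 8 * ‖D‖ ^ 2 ≤ 2 * (‖D‖ * ‖S‖) + 2 * (N * q) := by linarith
  have h6 : ‖D‖ * ‖S‖ = N * (‖D‖ * (‖S‖ / N)) := by field_simp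
  have h7 : ‖D‖ ^ 2 ≤ 16 * (‖D‖ * (‖S‖ / N)) + 16 * q := by
    rw [h6] at h5
    refine le_of_mul_le_mul_left ?_ (by positivity : 0 < N / 8)
    linarith
  rw [← div_pow]
  -- 16xy ≤ x²/2 + 128y² with x = ‖D‖ and y = ‖S‖/N; the x²/2 is absorbed on the left.
  nlinarith [sq_nonneg (‖D‖ - 16 * (‖S‖ / N))]

end LeastSquares

end BilinearObs

/-! ### Regressors, and exponential tails for sums over sliding windows -/

namespace BilinearObs

open scoped RealInnerProductSpace

/-- The vectorised regressor `u_t ⊗ ū_{t-1}`, so that `u_tᵀ M ū_{t-1} = ⟪vec M, feature L u t⟫`. -/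
noncomputable def feature {p : ℕ} (L : ℕ) (u : ℕ → EuclideanSpace ℝ (Fin p)) (t : ℕ) :
    EuclideanSpace ℝ (Fin p × (Fin L × Fin p)) :=
  WithLp.toLp 2 fun q => u t q.1 * u (t - 1 - q.2.1) q.2.2

/-- Independent, centred, isotropic inputs that are measurable and bounded everywhere. -/
structure RegularInputs {Ω : Type*} [MeasurableSpace Ω] (μ : Measure Ω) {p : ℕ} (T : ℕ)
    (u : ℕ → Ω → EuclideanSpace ℝ (Fin p)) (β : ℝ) : Prop where
  meas : ∀ t, Measurable (u t)
  bdd : ∀ t ω, ‖u t ω‖ ≤ β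
  indep : iIndepFun (fun t : Fin (T + 1) => u t) μ
  mean : ∀ t ≤ T, ∀ i, ∫ ω, u t ω i ∂μ = 0
  cov : ∀ t ≤ T, ∀ i j, ∫ ω, u t ω i * u t ω j ∂μ = if i = j then 1 else 0

variable {Ω : Type*} [MeasurableSpace Ω] {μ : Measure Ω}

/-- Independence is known only for the times up to T, whereas f and g take whole paths. Extending
the restricted paths by zero does not change f or g, as they only see S and S'. -/
lemma indepFun_of_dependsOn {E F G : Type*} [MeasurableSpace E] [Zero E] [MeasurableSpace F]
    [MeasurableSpace G] {T : ℕ} {X : ℕ → Ω → E} (hm : ∀ t, Measurable (X t))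
    (hX : iIndepFun (fun t : Fin (T + 1) => X t) μ) {S S' : Finset ℕ} (hSS : Disjoint S S')
    (hS : ∀ s ∈ S, s ≤ T) (hS' : ∀ s ∈ S', s ≤ T) {f : (ℕ → E) → F} {g : (ℕ → E) → G}
    (hf : Measurable f) (hg : Measurable g) (hfS : DependsOn f (S : Set ℕ))
    (hgS : DependsOn g (S' : Set ℕ)) :
    IndepFun (fun ω => f fun t => X t ω) (fun ω => g fun t => X t ω) μ := by
  have hS1 : ∀ s ∈ S, s < T + 1 := fun s hs => Nat.lt_succ_of_le (hS s hs)
  have hS2 : ∀ s ∈ S', s < T + 1 := fun s hs => Nat.lt_succ_of_le (hS' s hs)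
  have hdisj : Disjoint (S.attachFin hS1) (S'.attachFin hS2) := by
    rw [Finset.disjoint_left] at hSS ⊢
    intro a ha hb
    exact hSS ((Finset.mem_attachFin _).1 ha) ((Finset.mem_attachFin _).1 hb)
  have key := hX.indepFun_finset _ _ hdisj fun i => hm i
  let ext (R : Finset ℕ) (hR : ∀ s ∈ R, s < T + 1) : (R.attachFin hR → E) → ℕ → E :=
    fun y t => if ht : t ∈ R then y ⟨⟨t, hR t ht⟩, (Finset.mem_attachFin _).2 ht⟩ else 0
  have hext : ∀ R hR, Measurable (ext R hR) := fun R hR => by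
    refine measurable_pi_lambda _ fun t => ?_
    by_cases ht : t ∈ R
    · simp only [ext, ht, dite_true]
      exact measurable_pi_apply _
    · simp only [ext, ht, dite_false]
      exact measurable_const
  have h := key.comp (hf.comp (hext S hS1)) (hg.comp (hext S' hS2))
  convert! h using 1
  · ext ω
    refine hfS fun t ht => ?_
    have ht' : t ∈ S := ht
    simp [ext, ht']
  · ext ω
    refine hgS fun t ht => ?_
    have ht' : t ∈ S' := ht
    simp [ext, ht']

section Tail

variable {E : Type*} [MeasurableSpace E] [Zero E] {T L : ℕ} {X : ℕ → Ω → E}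

/-- Gaps larger than L make the windows [t - L, t] disjoint, so the factor at the latest time splits
off by independence. -/
lemma lintegral_prod_le_pow [IsProbabilityMeasure μ] (hm : ∀ t, Measurable (X t))
    (hX : iIndepFun (fun t : Fin (T + 1) => X t) μ) {g : ℕ → (ℕ → E) → ENNReal}
    (hg : ∀ t, Measurable (g t)) (hgd : ∀ t, DependsOn (g t) (Finset.Icc (t - L) t : Set ℕ))
    {c : ENNReal} (J : Finset ℕ) (hJ : ∀ t ∈ J, t ≤ T)
    (hsep : ∀ s ∈ J, ∀ t ∈ J, s < t → s + L < t)
    (hc : ∀ t ∈ J, ∫⁻ ω, g t (fun r => X r ω) ∂μ ≤ c) :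
    ∫⁻ ω, ∏ t ∈ J, g t (fun r => X r ω) ∂μ ≤ c ^ J.card := by
  have hpath : Measurable fun ω => fun r => X r ω := measurable_pi_lambda _ hm
  induction J using Finset.induction_on_max with
  | empty => simp
  | insert a J ha ih =>
    have haJ : a ∉ J := fun h => (ha a h).false
    have hind : IndepFun (fun ω => g a fun r => X r ω)
        (fun ω => ∏ t ∈ J, g t (fun r => X r ω)) μ := by
      refine indepFun_of_dependsOn (f := g a) (g := fun x => ∏ t ∈ J, g t x) hm hX
        (S := Finset.Icc (a - L) a) (S' := J.biUnion fun t => Finset.Icc (t - L) t)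
        ?_ ?_ ?_ (hg a) (Finset.measurable_fun_prod _ fun t _ => hg t) (hgd a) ?_
      · rw [Finset.disjoint_left]
        intro r hr hr'
        obtain ⟨t, ht, htr⟩ := Finset.mem_biUnion.1 hr'
        have := hsep t (Finset.mem_insert_of_mem ht) a (Finset.mem_insert_self _ _) (ha t ht)
        rw [Finset.mem_Icc] at hr htr
        omega
      · intro s hs
        exact (Finset.mem_Icc.1 hs).2.trans (hJ a (Finset.mem_insert_self _ _))
      · intro s hs
        obtain ⟨t, ht, hts⟩ := Finset.mem_biUnion.1 hs
        exact (Finset.mem_Icc.1 hts).2.trans (hJ t (Finset.mem_insert_of_mem ht))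
      · intro x y hxy
        refine Finset.prod_congr rfl fun t ht => hgd t fun r hr => hxy r ?_
        exact Finset.mem_coe.2 (Finset.mem_biUnion.2 ⟨t, ht, Finset.mem_coe.1 hr⟩)
    simp_rw [Finset.prod_insert haJ]
    rw [lintegral_mul_eq_lintegral_mul_lintegral_of_indepFun''
      (f := fun ω => g a fun r => X r ω) (g := fun ω => ∏ t ∈ J, g t (fun r => X r ω))
      ((hg a).comp hpath).aemeasurable
      (Finset.aemeasurable_fun_prod _ fun t _ => ((hg t).comp hpath).aemeasurable) hind,
      Finset.card_insert_of_notMem haJ, pow_succ']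
    refine mul_le_mul' (hc a (Finset.mem_insert_self _ _)) (ih ?_ ?_ ?_)
    · exact fun t ht => hJ t (Finset.mem_insert_of_mem ht)
    · exact fun s hs t ht => hsep s (Finset.mem_insert_of_mem hs) t (Finset.mem_insert_of_mem ht)
    · exact fun t ht => hc t (Finset.mem_insert_of_mem ht)

lemma card_filter_mod_le {a b r : ℕ} (k : ℕ) (hr : 0 < r) (hab : a ≤ b) :
    (((Finset.Ioc a b).filter fun t => t % r = k).card : ℝ) ≤ ((b : ℝ) - a) / r + 1 := by
  have hsub : ((Finset.Ioc a b).filter fun t => t % r = k) ⊆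
      (Finset.Ioc a b).filter fun t => t ≡ k [MOD r] := fun t ht => by
    rw [Finset.mem_filter] at ht ⊢
    refine ⟨ht.1, ?_⟩
    have h2 := ht.2
    subst h2
    exact (Nat.mod_modEq t r).symm
  have h1 := Nat.Ioc_filter_modEq_card a b hr k
  have hr' : (0 : ℚ) < r := by exact_mod_cast hr
  have hab' : (a : ℚ) ≤ b := by exact_mod_cast hab
  have h2 : (((Finset.Ioc a b).filter fun t => t ≡ k [MOD r]).card : ℚ) ≤
      ((b : ℚ) - a) / r + 1 := by
    have h3 : (((Finset.Ioc a b).filter fun t => t ≡ k [MOD r]).card : ℚ) =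
        ((max (⌊((b : ℚ) - k) / r⌋ - ⌊((a : ℚ) - k) / r⌋) 0 : ℤ) : ℚ) := by
      rw [← h1]
      simp
    rw [h3, Int.cast_max, Int.cast_sub, Int.cast_zero]
    refine max_le ?_ ?_
    · have h4 := Int.floor_le (((b : ℚ) - k) / r)
      have h5 := Int.lt_floor_add_one (((a : ℚ) - k) / r)
      have h6 : ((b : ℚ) - a) / r = ((b : ℚ) - k) / r - ((a : ℚ) - k) / r := by ring
      linarith
    · have : 0 ≤ ((b : ℚ) - a) / r := div_nonneg (by linarith) hr'.le
      linarith
  have h4 : (((Finset.Ioc a b).filter fun t => t ≡ k [MOD r]).card : ℝ) ≤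
      ((b : ℝ) - a) / r + 1 := by
    have := (Rat.cast_le (K := ℝ)).2 h2
    push_cast at this
    exact this
  exact le_trans (by exact_mod_cast Finset.card_le_card hsub) h4

/-- Within a residue class mod L + 1 the terms are independent. Jensen with weights 1/(L + 1) bounds
the exponential of the full sum by the average over classes, at the cost of replacing θ by θ/(L + 1)
but without a union over classes. -/
lemma measure_sum_ge_le [IsProbabilityMeasure μ] (hm : ∀ t, Measurable (X t))
    (hX : iIndepFun (fun t : Fin (T + 1) => X t) μ) {Z : ℕ → (ℕ → E) → ℝ}
    (hZ : ∀ t, Measurable (Z t)) (hZd : ∀ t, DependsOn (Z t) (Finset.Icc (t - L) t : Set ℕ))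
    {θ κ : ℝ} (hθ : 0 < θ) (hκ : 0 ≤ κ) (hLT : L ≤ T)
    (hmgf : ∀ t ∈ Finset.Icc (L + 1) T,
      ∫⁻ ω, ENNReal.ofReal (Real.exp (θ * Z t (fun r => X r ω))) ∂μ ≤ ENNReal.ofReal (Real.exp κ))
    (a : ℝ) :
    μ {ω | a ≤ ∑ t ∈ Finset.Icc (L + 1) T, Z t (fun r => X r ω)} ≤
      ENNReal.ofReal (Real.exp (κ * (((T : ℝ) - L) / (L + 1) + 1) - θ * a / (L + 1))) := by
  have hpath : Measurable fun ω => fun r => X r ω := measurable_pi_lambda _ hm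
  set J := Finset.Icc (L + 1) T with hJ
  have hJ' : J = Finset.Ioc L T := by ext; simp [hJ]
  set Jk : ℕ → Finset ℕ := fun k => J.filter fun t => t % (L + 1) = k with hJk
  set m : ℝ := ((T : ℝ) - L) / (L + 1) + 1 with hm'
  have hLpos : (0 : ℝ) < L + 1 := by positivity
  have hclass : ∀ k, ∫⁻ ω, ENNReal.ofReal (Real.exp (θ * ∑ t ∈ Jk k, Z t (fun r => X r ω))) ∂μ ≤
      ENNReal.ofReal (Real.exp (κ * m)) := fun k => by
    have h1 := lintegral_prod_le_pow (L := L) hm hX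
      (g := fun t x => ENNReal.ofReal (Real.exp (θ * Z t x))) (c := ENNReal.ofReal (Real.exp κ))
      (fun t => by have := hZ t; fun_prop)
      (fun t x y hxy => by simp only; rw [hZd t hxy]) (Jk k)
      (fun t ht => (Finset.mem_Icc.1 (Finset.mem_filter.1 ht).1).2)
      (fun s hs t ht hst => by
        have h1 := (Finset.mem_filter.1 hs).2
        have h2 := (Finset.mem_filter.1 ht).2
        have h3 : (L + 1) ∣ t - s := (Nat.modEq_iff_dvd' hst.le).1 (h1.trans h2.symm)
        have := Nat.le_of_dvd (by omega) h3
        omega)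
      (fun t ht => hmgf t (Finset.mem_filter.1 ht).1)
    refine le_trans (le_of_eq ?_) (h1.trans ?_)
    · refine lintegral_congr fun ω => ?_
      rw [← ENNReal.ofReal_prod_of_nonneg fun _ _ => (Real.exp_pos _).le, ← Real.exp_sum,
        Finset.mul_sum]
    · rw [← ENNReal.ofReal_pow (Real.exp_pos _).le, ← Real.exp_nat_mul]
      refine ENNReal.ofReal_le_ofReal (Real.exp_le_exp.2 ?_)
      rw [mul_comm]
      refine mul_le_mul_of_nonneg_left ?_ hκ
      have := card_filter_mod_le (a := L) (b := T) k (Nat.succ_pos L) hLT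
      rw [← hJ'] at this
      push_cast at this
      exact this
  have hjensen : ∀ ω, Real.exp (θ / (L + 1) * ∑ t ∈ J, Z t (fun r => X r ω)) ≤
      ∑ k ∈ Finset.range (L + 1),
        1 / ((L : ℝ) + 1) * Real.exp (θ * ∑ t ∈ Jk k, Z t (fun r => X r ω)) := fun ω => by
    have h1 := convexOn_exp.map_sum_le (t := Finset.range (L + 1))
      (w := fun _ => 1 / ((L : ℝ) + 1)) (p := fun k => θ * ∑ t ∈ Jk k, Z t (fun r => X r ω))
      (fun _ _ => by positivity) (by simp; field_simp) (fun _ _ => Set.mem_univ _)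
    simp only [smul_eq_mul] at h1
    refine le_trans (le_of_eq ?_) h1
    congr 1
    rw [← Finset.sum_fiberwise_of_maps_to (s := J) (t := Finset.range (L + 1))
      (g := fun t => t % (L + 1)) (fun t _ => Finset.mem_range.2 (Nat.mod_lt _ (Nat.succ_pos _))),
      Finset.mul_sum]
    refine Finset.sum_congr rfl fun k _ => ?_
    simp only [hJk]
    ring
  have hmeasS : ∀ k, Measurable fun ω =>
      ENNReal.ofReal (Real.exp (θ * ∑ t ∈ Jk k, Z t (fun r => X r ω))) := fun k => by
    have : Measurable fun ω => ∑ t ∈ Jk k, Z t (fun r => X r ω) :=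
      Finset.measurable_fun_sum _ fun t _ => (hZ t).comp hpath
    fun_prop
  have hint : ∫⁻ ω, ENNReal.ofReal (Real.exp (θ / (L + 1) * ∑ t ∈ J, Z t (fun r => X r ω))) ∂μ ≤
      ENNReal.ofReal (Real.exp (κ * m)) := by
    calc _ ≤ ∫⁻ ω, ∑ k ∈ Finset.range (L + 1), ENNReal.ofReal (1 / ((L : ℝ) + 1)) *
          ENNReal.ofReal (Real.exp (θ * ∑ t ∈ Jk k, Z t (fun r => X r ω))) ∂μ := by
          refine lintegral_mono fun ω => (ENNReal.ofReal_le_ofReal (hjensen ω)).trans ?_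
          rw [ENNReal.ofReal_sum_of_nonneg fun _ _ => by positivity]
          refine Finset.sum_le_sum fun k _ => ?_
          rw [ENNReal.ofReal_mul (by positivity)]
      _ = ∑ k ∈ Finset.range (L + 1), ENNReal.ofReal (1 / ((L : ℝ) + 1)) *
          ∫⁻ ω, ENNReal.ofReal (Real.exp (θ * ∑ t ∈ Jk k, Z t (fun r => X r ω))) ∂μ := by
          rw [lintegral_finsetSum _ fun k _ => (hmeasS k).const_mul _]
          exact Finset.sum_congr rfl fun k _ => lintegral_const_mul _ (hmeasS k)
      _ ≤ ∑ k ∈ Finset.range (L + 1), ENNReal.ofReal (1 / ((L : ℝ) + 1)) *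
          ENNReal.ofReal (Real.exp (κ * m)) := by
          gcongr with k _
          exact hclass k
      _ = ENNReal.ofReal (Real.exp (κ * m)) := by
          rw [Finset.sum_const, Finset.card_range, nsmul_eq_mul, ← mul_assoc,
            ← ENNReal.ofReal_natCast, ← ENNReal.ofReal_mul (by positivity)]
          rw [show ((L + 1 : ℕ) : ℝ) * (1 / ((L : ℝ) + 1)) = 1 by push_cast; field_simp]
          simp
  have hmeasJ : Measurable fun ω =>
      ENNReal.ofReal (Real.exp (θ / (L + 1) * ∑ t ∈ J, Z t (fun r => X r ω))) := by
    have : Measurable fun ω => ∑ t ∈ J, Z t (fun r => X r ω) :=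
      Finset.measurable_fun_sum _ fun t _ => (hZ t).comp hpath
    fun_prop
  have hmarkov := mul_meas_ge_le_lintegral₀ (μ := μ) hmeasJ.aemeasurable
    (ENNReal.ofReal (Real.exp (θ / (L + 1) * a)))
  have hsub : {ω | a ≤ ∑ t ∈ J, Z t (fun r => X r ω)} ⊆
      {ω | ENNReal.ofReal (Real.exp (θ / (L + 1) * a)) ≤
        ENNReal.ofReal (Real.exp (θ / (L + 1) * ∑ t ∈ J, Z t (fun r => X r ω)))} := fun ω hω => by
    refine ENNReal.ofReal_le_ofReal (Real.exp_le_exp.2 ?_)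
    exact mul_le_mul_of_nonneg_left hω (by positivity)
  have h1 : ENNReal.ofReal (Real.exp (θ / (L + 1) * a)) *
      μ {ω | a ≤ ∑ t ∈ J, Z t (fun r => X r ω)} ≤ ENNReal.ofReal (Real.exp (κ * m)) :=
    (mul_le_mul_right (measure_mono hsub) _).trans (hmarkov.trans hint)
  have h2 : ENNReal.ofReal (Real.exp (κ * m - θ * a / (L + 1))) =
      ENNReal.ofReal (Real.exp (κ * m)) / ENNReal.ofReal (Real.exp (θ / (L + 1) * a)) := by
    rw [← ENNReal.ofReal_div_of_pos (Real.exp_pos _), ← Real.exp_sub]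
    congr 3
    ring
  rw [h2, ENNReal.le_div_iff_mul_le (Or.inl (by simp [Real.exp_pos])) (Or.inl (by simp)), mul_comm]
  exact h1

end Tail

end BilinearObs

/-! ### Input moments, and the noise–regressor correlation for frozen noise -/

namespace BilinearObs

open scoped RealInnerProductSpace

variable {Ω : Type*} [MeasurableSpace Ω] {μ : Measure Ω}

lemma integral_sq_sum_of_orthogonal {ι : Type*} [LinearOrder ι] (J : Finset ι) (f : ι → Ω → ℝ)
    (hint : ∀ s ∈ J, ∀ t ∈ J, Integrable (fun ω => f s ω * f t ω) μ)
    (horth : ∀ s ∈ J, ∀ t ∈ J, s < t → ∫ ω, f s ω * f t ω ∂μ = 0) :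
    ∫ ω, (∑ t ∈ J, f t ω) ^ 2 ∂μ = ∑ t ∈ J, ∫ ω, f t ω ^ 2 ∂μ := by
  simp_rw [pow_two, Finset.sum_mul_sum]
  rw [integral_finsetSum _ fun s hs => integrable_finsetSum _ fun t ht => hint s hs t ht]
  refine Finset.sum_congr rfl fun s hs => ?_
  rw [integral_finsetSum _ fun t ht => hint s hs t ht]
  refine Finset.sum_eq_single_of_mem s hs fun t ht hts => ?_
  rcases lt_or_gt_of_ne hts with h | h
  · rw [← horth t ht s hs h]
    exact integral_congr_ae (Filter.Eventually.of_forall fun ω => mul_comm _ _)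
  · exact horth s hs t ht h

/-- A measurable, uniformly bounded real function. -/
def BddMeas {α : Type*} [MeasurableSpace α] (f : α → ℝ) : Prop :=
  Measurable f ∧ ∃ c, ∀ a, |f a| ≤ c

namespace BddMeas

variable {α : Type*} [MeasurableSpace α] {f g : α → ℝ}

lemma const (c : ℝ) : BddMeas fun _ : α => c := ⟨measurable_const, |c|, fun _ => le_rfl⟩

lemma mul (hf : BddMeas f) (hg : BddMeas g) : BddMeas fun a => f a * g a := by
  obtain ⟨hf, c, hc⟩ := hf
  obtain ⟨hg, d, hd⟩ := hg
  refine ⟨hf.mul hg, c * d, fun a => ?_⟩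
  rw [abs_mul]
  exact mul_le_mul (hc a) (hd a) (abs_nonneg _) ((abs_nonneg _).trans (hc a))

lemma add (hf : BddMeas f) (hg : BddMeas g) : BddMeas fun a => f a + g a := by
  obtain ⟨hf, c, hc⟩ := hf
  obtain ⟨hg, d, hd⟩ := hg
  exact ⟨hf.add hg, c + d, fun a => (abs_add_le _ _).trans (add_le_add (hc a) (hd a))⟩

lemma pow (hf : BddMeas f) (k : ℕ) : BddMeas fun a => f a ^ k := by
  obtain ⟨hf, c, hc⟩ := hf
  refine ⟨hf.pow_const k, c ^ k, fun a => ?_⟩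
  rw [abs_pow]
  exact pow_le_pow_left₀ (abs_nonneg _) (hc a) k

lemma sum {ι : Type*} {F : ι → α → ℝ} {J : Finset ι} (hF : ∀ i ∈ J, BddMeas (F i)) :
    BddMeas fun a => ∑ i ∈ J, F i a := by
  classical
  induction J using Finset.induction_on with
  | empty => simpa using const 0
  | insert i J hi ih =>
    simp_rw [Finset.sum_insert hi]
    exact (hF i (Finset.mem_insert_self _ _)).add
      (ih fun j hj => hF j (Finset.mem_insert_of_mem hj))

lemma integrable [IsFiniteMeasure μ] {f : Ω → ℝ} (hf : BddMeas f) : Integrable f μ := by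
  obtain ⟨hf, c, hc⟩ := hf
  exact Integrable.of_bound hf.aestronglyMeasurable c (Filter.Eventually.of_forall hc)

end BddMeas

namespace RegularInputs

variable {p T L : ℕ} {u : ℕ → Ω → EuclideanSpace ℝ (Fin p)} {β : ℝ}

lemma bddMeas_coord (hu : RegularInputs μ T u β) (t : ℕ) (i : Fin p) :
    BddMeas fun ω => u t ω i :=
  ⟨by have := hu.meas t; fun_prop, β, fun ω => (PiLp.norm_apply_le _ i).trans (hu.bdd t ω)⟩

lemma bddMeas_inner (hu : RegularInputs μ T u β) (t : ℕ) (h : EuclideanSpace ℝ (Fin p)) :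
    BddMeas fun ω => ⟪h, u t ω⟫ := by
  simp_rw [PiLp.inner_apply]
  exact BddMeas.sum fun i _ => (hu.bddMeas_coord t i).mul (BddMeas.const _)

lemma measurable_path (hu : RegularInputs μ T u β) : Measurable fun ω => fun r => u r ω :=
  measurable_pi_lambda _ hu.meas

lemma integral_mul_of_dependsOn (hu : RegularInputs μ T u β) {S S' : Finset ℕ}
    (hSS : Disjoint S S') (hS : ∀ s ∈ S, s ≤ T) (hS' : ∀ s ∈ S', s ≤ T)
    {f g : (ℕ → EuclideanSpace ℝ (Fin p)) → ℝ}
    (hf : Measurable f) (hg : Measurable g) (hfS : DependsOn f (S : Set ℕ))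
    (hgS : DependsOn g (S' : Set ℕ)) :
    ∫ ω, f (fun r => u r ω) * g (fun r => u r ω) ∂μ =
      (∫ ω, f (fun r => u r ω) ∂μ) * ∫ ω, g (fun r => u r ω) ∂μ :=
  (indepFun_of_dependsOn hu.meas hu.indep hSS hS hS' hf hg hfS
    hgS).integral_fun_mul_eq_mul_integral (hf.comp hu.measurable_path).aestronglyMeasurable
    (hg.comp hu.measurable_path).aestronglyMeasurable

/-- The source of all cancellations below: an input occurring once, and linearly, kills the
expectation. -/
lemma integral_coord_mul_eq_zero (hu : RegularInputs μ T u β) {r : ℕ} (hr : r ≤ T) (k : Fin p)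
    {S : Finset ℕ} (hrS : r ∉ S) (hS : ∀ s ∈ S, s ≤ T)
    {g : (ℕ → EuclideanSpace ℝ (Fin p)) → ℝ} (hg : Measurable g) (hgS : DependsOn g (S : Set ℕ)) :
    ∫ ω, u r ω k * g (fun s => u s ω) ∂μ = 0 := by
  have := hu.integral_mul_of_dependsOn (S := {r}) (S' := S) (by simpa using hrS)
    (by simpa using hr) hS (f := fun x => x r k) (by fun_prop) hg
    (fun x y hxy => by simp only; rw [hxy r (by simp)]) hgS
  simp only at this
  rw [this, hu.mean r hr k, zero_mul]

lemma integral_norm_sq (hu : RegularInputs μ T u β) [IsProbabilityMeasure μ] {t : ℕ} (ht : t ≤ T) :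
    ∫ ω, ‖u t ω‖ ^ 2 ∂μ = p := by
  simp_rw [EuclideanSpace.real_norm_sq_eq, pow_two]
  rw [integral_finsetSum _ fun i _ =>
    ((hu.bddMeas_coord t i).mul (hu.bddMeas_coord t i)).integrable]
  simp [hu.cov t ht]

lemma integral_inner_sq (hu : RegularInputs μ T u β) [IsProbabilityMeasure μ] {t : ℕ} (ht : t ≤ T)
    (h : EuclideanSpace ℝ (Fin p)) : ∫ ω, ⟪h, u t ω⟫ ^ 2 ∂μ = ‖h‖ ^ 2 := by
  have h1 : ∀ ω, ⟪h, u t ω⟫ ^ 2 = ∑ i, ∑ j, h i * h j * (u t ω i * u t ω j) := fun ω => by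
    rw [PiLp.inner_apply, pow_two, Finset.sum_mul_sum]
    refine Finset.sum_congr rfl fun i _ => Finset.sum_congr rfl fun j _ => ?_
    simp
    ring
  have hb : ∀ i j, Integrable (fun ω => h i * h j * (u t ω i * u t ω j)) μ := fun i j =>
    ((BddMeas.const _).mul ((hu.bddMeas_coord t i).mul (hu.bddMeas_coord t j))).integrable
  simp_rw [h1]
  rw [integral_finsetSum _ fun i _ => integrable_finsetSum _ fun j _ => hb i j]
  rw [EuclideanSpace.real_norm_sq_eq]
  refine Finset.sum_congr rfl fun i _ => ?_
  rw [integral_finsetSum _ fun j _ => hb i j]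
  simp_rw [integral_const_mul, hu.cov t ht]
  simp [pow_two]

/-- E‖u_0‖² = p is at most β². This keeps the scale β⁴L of the Chernoff bound at least 1. -/
lemma one_le_sq [IsProbabilityMeasure μ] (hu : RegularInputs μ T u β) (hp : 1 ≤ p) :
    1 ≤ β ^ 2 := by
  have h1 := hu.integral_norm_sq (Nat.zero_le T)
  have hb : BddMeas fun ω => ‖u 0 ω‖ ^ 2 := by
    simp_rw [EuclideanSpace.real_norm_sq_eq]
    exact BddMeas.sum fun i _ => (hu.bddMeas_coord 0 i).pow 2
  have h2 : ∫ ω, ‖u 0 ω‖ ^ 2 ∂μ ≤ ∫ _, β ^ 2 ∂μ :=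
    integral_mono hb.integrable (integrable_const _) fun ω =>
      pow_le_pow_left₀ (norm_nonneg _) (hu.bdd 0 ω) 2
  rw [h1, integral_const] at h2
  have h3 : (1 : ℝ) ≤ p := by exact_mod_cast hp
  simp at h2
  linarith

/-- Conditionally on the noise, the second moment of the noise-regressor correlation. -/
lemma integral_norm_sq_sum_le [IsProbabilityMeasure μ] (hu : RegularInputs μ T u β)
    (ζ : ℕ → ℝ) (h : ℕ → EuclideanSpace ℝ (Fin p)) :
    ∫ ω, ‖∑ t ∈ Finset.Icc (L + 1) T, (ζ t + ⟪h t, u t ω⟫) • feature L (fun r => u r ω) t‖ ^ 2 ∂μ ≤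
      L * p * ∑ t ∈ Finset.Icc (L + 1) T, (2 * p * ζ t ^ 2 + 2 * β ^ 2 * ‖h t‖ ^ 2) := by
  set J := Finset.Icc (L + 1) T with hJ
  let a : ℕ → (ℕ → EuclideanSpace ℝ (Fin p)) → ℝ := fun t x => ζ t + ⟪h t, x t⟫
  have ha : ∀ t, Measurable (a t) := fun t => by
    have : Measurable fun x : ℕ → EuclideanSpace ℝ (Fin p) => x t := measurable_pi_apply t
    fun_prop
  have hab : ∀ t, BddMeas fun ω => ζ t + ⟪h t, u t ω⟫ := fun t =>
    (BddMeas.const _).add (hu.bddMeas_inner t _)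
  let f : (Fin p × (Fin L × Fin p)) → ℕ → Ω → ℝ := fun q t ω =>
    (ζ t + ⟪h t, u t ω⟫) * (u t ω q.1 * u (t - 1 - q.2.1) ω q.2.2)
  have hf : ∀ q t, BddMeas (f q t) := fun q t =>
    (hab t).mul ((hu.bddMeas_coord t _).mul (hu.bddMeas_coord _ _))
  have hnorm : ∀ ω, ‖∑ t ∈ J, (ζ t + ⟪h t, u t ω⟫) • feature L (fun r => u r ω) t‖ ^ 2 =
      ∑ q, (∑ t ∈ J, f q t ω) ^ 2 := fun ω => by
    rw [EuclideanSpace.real_norm_sq_eq]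
    refine Finset.sum_congr rfl fun q _ => ?_
    congr 1
    simp [f, feature]
  simp_rw [hnorm]
  rw [integral_finsetSum _ fun q _ => ((BddMeas.sum fun t _ => hf q t).pow 2).integrable]
  have horth : ∀ q, ∫ ω, (∑ t ∈ J, f q t ω) ^ 2 ∂μ = ∑ t ∈ J, ∫ ω, f q t ω ^ 2 ∂μ := fun q => by
    refine integral_sq_sum_of_orthogonal J _ (fun s _ t _ => ((hf q s).mul (hf q t)).integrable) ?_
    intro s hs t ht hst
    rw [hJ, Finset.mem_Icc] at hs ht
    have hq := q.2.1.2
    -- The singled-out factor is the lagged input of the earlier term: its time is smaller than s, t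
    -- and t - 1 - j. The newest input u_t would not do, since it also enters through ⟪h_t, u_t⟫.
    have := hu.integral_coord_mul_eq_zero (r := s - 1 - q.2.1) (by omega) q.2.2
      (S := {s, t, t - 1 - q.2.1}) (by simp; omega) (by simp; omega)
      (g := fun x => a s x * x s q.1 * (a t x * (x t q.1 * x (t - 1 - q.2.1) q.2.2)))
      (by have := ha s; have := ha t; fun_prop)
      (fun x y hxy => by
        simp only [a]
        rw [hxy s (by simp), hxy t (by simp), hxy (t - 1 - q.2.1) (by simp)])
    rw [← this]
    refine integral_congr_ae (Filter.Eventually.of_forall fun ω => ?_)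
    simp only [f, a]
    ring
  have hdiag : ∀ q, ∀ t ∈ J, ∫ ω, f q t ω ^ 2 ∂μ =
      ∫ ω, (ζ t + ⟪h t, u t ω⟫) ^ 2 * u t ω q.1 ^ 2 ∂μ := fun q t ht => by
    rw [hJ, Finset.mem_Icc] at ht
    have hq := q.2.1.2
    -- The lagged coordinate is independent of u_t and has second moment 1. The Lp columns therefore
    -- contribute equally, which produces the factor Lp.
    have := hu.integral_mul_of_dependsOn (S := {t}) (S' := {t - 1 - (q.2.1 : ℕ)})
      (by simp; omega) (by simpa using ht.2) (by simp; omega)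
      (f := fun x => a t x ^ 2 * x t q.1 ^ 2) (g := fun x => x (t - 1 - q.2.1) q.2.2 ^ 2)
      (by have := ha t; fun_prop) (by fun_prop)
      (fun x y hxy => by simp only [a]; rw [hxy t (by simp)])
      (fun x y hxy => by simp only; rw [hxy (t - 1 - q.2.1) (by simp)])
    have hc := hu.cov (t - 1 - q.2.1) (by omega) q.2.2 q.2.2
    simp only [if_true, ← pow_two] at hc
    rw [hc, mul_one] at this
    rw [← this]
    refine integral_congr_ae (Filter.Eventually.of_forall fun ω => ?_)
    simp only [f, a]
    ring
  rw [Finset.sum_congr rfl fun q _ => horth q, Finset.sum_comm, Finset.mul_sum]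
  refine Finset.sum_le_sum fun t ht => ?_
  have htT : t ≤ T := (Finset.mem_Icc.1 ht).2
  rw [Finset.sum_congr rfl fun q _ => hdiag q t ht, Fintype.sum_prod_type]
  simp only [Finset.sum_const, Finset.card_univ, Fintype.card_prod, Fintype.card_fin,
    nsmul_eq_mul, ← Finset.mul_sum]
  rw [← integral_finsetSum _ fun i _ => (((hab t).pow 2).mul
    ((hu.bddMeas_coord t i).pow 2)).integrable]
  push_cast
  refine mul_le_mul_of_nonneg_left ?_ (by positivity)
  have hn : BddMeas fun ω => ‖u t ω‖ ^ 2 := by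
    simp_rw [EuclideanSpace.real_norm_sq_eq]
    exact BddMeas.sum fun i _ => (hu.bddMeas_coord t i).pow 2
  have hi1 : Integrable (fun ω => 2 * ζ t ^ 2 * ‖u t ω‖ ^ 2) μ :=
    ((BddMeas.const _).mul hn).integrable
  have hi2 : Integrable (fun ω => 2 * β ^ 2 * ⟪h t, u t ω⟫ ^ 2) μ :=
    ((BddMeas.const _).mul ((hu.bddMeas_inner t _).pow 2)).integrable
  -- The two halves of (ζ + ⟪h, u⟫)² ≤ 2ζ² + 2⟪h, u⟫² are treated differently: E‖u‖² = p for the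
  -- first, ‖u‖ ≤ β and isotropy for the second.
  calc _ ≤ ∫ ω, (2 * ζ t ^ 2 * ‖u t ω‖ ^ 2 + 2 * β ^ 2 * ⟪h t, u t ω⟫ ^ 2) ∂μ := by
        refine integral_mono (BddMeas.sum fun i _ => ((hab t).pow 2).mul
          ((hu.bddMeas_coord t i).pow 2)).integrable (hi1.add hi2) fun ω => ?_
        simp only
        rw [← Finset.mul_sum, ← EuclideanSpace.real_norm_sq_eq]
        have h1 : ‖u t ω‖ ^ 2 ≤ β ^ 2 := pow_le_pow_left₀ (norm_nonneg _) (hu.bdd t ω) 2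
        have h2 : (ζ t + ⟪h t, u t ω⟫) ^ 2 ≤ 2 * ζ t ^ 2 + 2 * ⟪h t, u t ω⟫ ^ 2 := by
          nlinarith [sq_nonneg (ζ t - ⟪h t, u t ω⟫)]
        have h3 := mul_le_mul_of_nonneg_right h2 (sq_nonneg ‖u t ω‖)
        have h4 := mul_le_mul_of_nonneg_left h1 (sq_nonneg ⟪h t, u t ω⟫)
        linarith
    _ = 2 * p * ζ t ^ 2 + 2 * β ^ 2 * ‖h t‖ ^ 2 := by
        rw [integral_add hi1 hi2, integral_const_mul, integral_const_mul,
          hu.integral_norm_sq htT, hu.integral_inner_sq htT]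
        ring

end RegularInputs

end BilinearObs

/-! ### Lower bound for the empirical covariance of the regressors -/

namespace BilinearObs

open scoped RealInnerProductSpace

variable {Ω : Type*} [MeasurableSpace Ω] {μ : Measure Ω}

lemma inner_feature {p L : ℕ} (v : EuclideanSpace ℝ (Fin p × (Fin L × Fin p)))
    (x : ℕ → EuclideanSpace ℝ (Fin p)) (t : ℕ) :
    ⟪v, feature L x t⟫ = ∑ q, v q * (x t q.1 * x (t - 1 - q.2.1) q.2.2) := by
  rw [PiLp.inner_apply]
  exact Finset.sum_congr rfl fun q _ => by simp [feature, mul_comm]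

lemma norm_sq_feature {p L : ℕ} (x : ℕ → EuclideanSpace ℝ (Fin p)) (t : ℕ) :
    ‖feature L x t‖ ^ 2 = ‖x t‖ ^ 2 * ∑ j : Fin L, ‖x (t - 1 - j)‖ ^ 2 := by
  simp_rw [EuclideanSpace.real_norm_sq_eq]
  rw [Fintype.sum_prod_type, Finset.sum_mul]
  refine Finset.sum_congr rfl fun i _ => ?_
  rw [Fintype.sum_prod_type, Finset.mul_sum]
  refine Finset.sum_congr rfl fun j _ => ?_
  rw [Finset.mul_sum]
  exact Finset.sum_congr rfl fun k _ => by simp [feature, mul_pow]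

namespace RegularInputs

variable {p T L : ℕ} {u : ℕ → Ω → EuclideanSpace ℝ (Fin p)} {β : ℝ}

lemma bddMeas_inner_feature (hu : RegularInputs μ T u β)
    (v : EuclideanSpace ℝ (Fin p × (Fin L × Fin p))) (t : ℕ) :
    BddMeas fun ω => ⟪v, feature L (fun r => u r ω) t⟫ := by
  simp_rw [inner_feature]
  exact BddMeas.sum fun q _ => (BddMeas.const _).mul
    ((hu.bddMeas_coord _ _).mul (hu.bddMeas_coord _ _))

/-- For equal lags the expectation factors into two input covariances. For different lags one lagged
input occurs only once and is centred. -/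
lemma integral_feature_mul_feature (hu : RegularInputs μ T u β) {t : ℕ}
    (ht : t ∈ Finset.Icc (L + 1) T) (q q' : Fin p × (Fin L × Fin p)) :
    ∫ ω, (u t ω q.1 * u (t - 1 - q.2.1) ω q.2.2) * (u t ω q'.1 * u (t - 1 - q'.2.1) ω q'.2.2) ∂μ =
      if q = q' then 1 else 0 := by
  obtain ⟨i, j, k⟩ := q
  obtain ⟨i', j', k'⟩ := q'
  rw [Finset.mem_Icc] at ht
  have hj := j.2
  have hj' := j'.2
  simp only
  by_cases hjj : j = j'
  · subst hjj
    have := hu.integral_mul_of_dependsOn (S := {t}) (S' := {t - 1 - (j : ℕ)})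
      (by simp; omega) (by simpa using ht.2) (by simp; omega)
      (f := fun x => x t i * x t i') (g := fun x => x (t - 1 - j) k * x (t - 1 - j) k')
      (by fun_prop) (by fun_prop)
      (fun x y hxy => by simp only; rw [hxy t (by simp)])
      (fun x y hxy => by simp only; rw [hxy (t - 1 - j) (by simp)])
    simp only [hu.cov t ht.2, hu.cov (t - 1 - j) (by omega)] at this
    calc _ = ∫ ω, u t ω i * u t ω i' * (u (t - 1 - j) ω k * u (t - 1 - j) ω k') ∂μ :=
          integral_congr_ae (Filter.Eventually.of_forall fun ω => by ring)
      _ = _ := by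
        rw [this]
        by_cases h1 : i = i' <;> by_cases h2 : k = k' <;> simp [h1, h2]
  · have hne : (j : ℕ) ≠ j' := fun h => hjj (Fin.ext h)
    have := hu.integral_coord_mul_eq_zero (r := t - 1 - j) (by omega) k
      (S := {t, t - 1 - (j' : ℕ)}) (by simp; omega) (by simp; omega)
      (g := fun x => x t i * (x t i' * x (t - 1 - j') k')) (by fun_prop)
      (fun x y hxy => by simp only; rw [hxy t (by simp), hxy (t - 1 - j') (by simp)])
    rw [if_neg (by simp [hjj]), ← this]
    exact integral_congr_ae (Filter.Eventually.of_forall fun ω => by ring)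

lemma integral_inner_feature_sq [IsProbabilityMeasure μ] (hu : RegularInputs μ T u β) {t : ℕ}
    (ht : t ∈ Finset.Icc (L + 1) T) (v : EuclideanSpace ℝ (Fin p × (Fin L × Fin p))) :
    ∫ ω, ⟪v, feature L (fun r => u r ω) t⟫ ^ 2 ∂μ = ‖v‖ ^ 2 := by
  have h1 : ∀ ω, ⟪v, feature L (fun r => u r ω) t⟫ ^ 2 = ∑ q, ∑ q', v q * v q' *
      ((u t ω q.1 * u (t - 1 - q.2.1) ω q.2.2) * (u t ω q'.1 * u (t - 1 - q'.2.1) ω q'.2.2)) :=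
    fun ω => by
      rw [inner_feature, pow_two, Finset.sum_mul_sum]
      exact Finset.sum_congr rfl fun q _ => Finset.sum_congr rfl fun q' _ => by ring
  have hb : ∀ q q', Integrable (fun ω => v q * v q' *
      ((u t ω q.1 * u (t - 1 - q.2.1) ω q.2.2) *
        (u t ω q'.1 * u (t - 1 - q'.2.1) ω q'.2.2))) μ := fun q q' =>
    ((BddMeas.const _).mul (((hu.bddMeas_coord _ _).mul (hu.bddMeas_coord _ _)).mul
      ((hu.bddMeas_coord _ _).mul (hu.bddMeas_coord _ _)))).integrable
  simp_rw [h1]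
  rw [integral_finsetSum _ fun q _ => integrable_finsetSum _ fun q' _ => hb q q',
    EuclideanSpace.real_norm_sq_eq]
  refine Finset.sum_congr rfl fun q _ => ?_
  rw [integral_finsetSum _ fun q' _ => hb q q']
  simp_rw [integral_const_mul, hu.integral_feature_mul_feature ht]
  simp [pow_two]

lemma inner_feature_sq_le (hu : RegularInputs μ T u β)
    {v : EuclideanSpace ℝ (Fin p × (Fin L × Fin p))} (hv : ‖v‖ ≤ 1) (t : ℕ) (ω : Ω) :
    ⟪v, feature L (fun r => u r ω) t⟫ ^ 2 ≤ β ^ 4 * L := by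
  have hsq : ∀ r, ‖u r ω‖ ^ 2 ≤ β ^ 2 := fun r =>
    pow_le_pow_left₀ (norm_nonneg _) (hu.bdd r ω) 2
  have h1 : ‖feature L (fun r => u r ω) t‖ ^ 2 ≤ β ^ 2 * (L * β ^ 2) := by
    rw [norm_sq_feature]
    refine mul_le_mul (hsq t) ?_ (by positivity) (by positivity)
    calc _ ≤ ∑ _j : Fin L, β ^ 2 := Finset.sum_le_sum fun j _ => hsq _
      _ = _ := by simp
  have h2 := abs_real_inner_le_norm v (feature L (fun r => u r ω) t)
  have h3 : ‖v‖ * ‖feature L (fun r => u r ω) t‖ ≤ ‖feature L (fun r => u r ω) t‖ :=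
    mul_le_of_le_one_left (norm_nonneg _) hv
  calc _ = |⟪v, feature L (fun r => u r ω) t⟫| ^ 2 := (sq_abs _).symm
    _ ≤ ‖feature L (fun r => u r ω) t‖ ^ 2 := by gcongr; exact h2.trans h3
    _ ≤ _ := h1.trans (le_of_eq (by ring))

/-- A Bernstein estimate: 0 ≤ Y ≤ b and E Y ≤ 1 keep the variance below b instead of b². -/
lemma integral_exp_feature_le [IsProbabilityMeasure μ] (hu : RegularInputs μ T u β) {t : ℕ}
    (ht : t ∈ Finset.Icc (L + 1) T) {v : EuclideanSpace ℝ (Fin p × (Fin L × Fin p))}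
    (hv : ‖v‖ ≤ 1) (hb : 1 ≤ β ^ 4 * L) {θ : ℝ} (hθ : |θ| * (β ^ 4 * L) ≤ 1) :
    ∫⁻ ω, ENNReal.ofReal (Real.exp (θ * (⟪v, feature L (fun r => u r ω) t⟫ ^ 2 - ‖v‖ ^ 2))) ∂μ ≤
      ENNReal.ofReal (Real.exp (θ ^ 2 * (β ^ 4 * L))) := by
  set b : ℝ := β ^ 4 * L with hbdef
  set Y : Ω → ℝ := fun ω => ⟪v, feature L (fun r => u r ω) t⟫ ^ 2 with hY
  have hYb : BddMeas Y := (hu.bddMeas_inner_feature v t).pow 2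
  have hZb : BddMeas fun ω => Y ω - ‖v‖ ^ 2 := by
    simpa [sub_eq_add_neg] using hYb.add (BddMeas.const (-‖v‖ ^ 2))
  have hv2 : ‖v‖ ^ 2 ≤ 1 := pow_le_one₀ (norm_nonneg _) hv
  have hY0 : ∀ ω, 0 ≤ Y ω := fun ω => sq_nonneg _
  have hYle : ∀ ω, Y ω ≤ b := fun ω => hu.inner_feature_sq_le hv t ω
  have hEY : ∫ ω, Y ω ∂μ = ‖v‖ ^ 2 := hu.integral_inner_feature_sq ht v
  have hZabs : ∀ ω, |Y ω - ‖v‖ ^ 2| ≤ b := fun ω => by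
    rw [abs_le]
    constructor <;> linarith [hY0 ω, hYle ω, sq_nonneg ‖v‖]
  -- e^x ≤ 1 + x + x² for |x| ≤ 1, with Y² replaced by bY so that only the first moment of Y is
  -- needed.
  have hpt : ∀ ω, Real.exp (θ * (Y ω - ‖v‖ ^ 2)) ≤
      1 + θ * (Y ω - ‖v‖ ^ 2) + θ ^ 2 * (b * Y ω - 2 * ‖v‖ ^ 2 * Y ω + ‖v‖ ^ 4) := fun ω => by
    have h1 : |θ * (Y ω - ‖v‖ ^ 2)| ≤ 1 := by
      rw [abs_mul]
      exact (mul_le_mul_of_nonneg_left (hZabs ω) (abs_nonneg _)).trans hθ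
    have h2 := (abs_le.1 (Real.abs_exp_sub_one_sub_id_le h1)).2
    have h3 : Y ω * Y ω ≤ b * Y ω := mul_le_mul_of_nonneg_right (hYle ω) (hY0 ω)
    have h4 := mul_le_mul_of_nonneg_left h3 (sq_nonneg θ)
    nlinarith
  have hR : BddMeas fun ω =>
      1 + θ * (Y ω - ‖v‖ ^ 2) + θ ^ 2 * (b * Y ω - 2 * ‖v‖ ^ 2 * Y ω + ‖v‖ ^ 4) := by
    have h1 := ((BddMeas.const 1).add ((BddMeas.const θ).mul hZb)).add
      ((BddMeas.const (θ ^ 2)).mul ((((BddMeas.const b).mul hYb).add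
        ((BddMeas.const (-(2 * ‖v‖ ^ 2))).mul hYb)).add (BddMeas.const (‖v‖ ^ 4))))
    convert! h1 using 2
    ring
  have hint : ∫ ω, (1 + θ * (Y ω - ‖v‖ ^ 2) +
      θ ^ 2 * (b * Y ω - 2 * ‖v‖ ^ 2 * Y ω + ‖v‖ ^ 4)) ∂μ =
      1 + θ ^ 2 * (b * ‖v‖ ^ 2 - ‖v‖ ^ 4) := by
    have hre : ∀ ω, 1 + θ * (Y ω - ‖v‖ ^ 2) +
        θ ^ 2 * (b * Y ω - 2 * ‖v‖ ^ 2 * Y ω + ‖v‖ ^ 4) =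
        (θ + θ ^ 2 * (b - 2 * ‖v‖ ^ 2)) * Y ω + (1 - θ * ‖v‖ ^ 2 + θ ^ 2 * ‖v‖ ^ 4) :=
      fun ω => by ring
    simp_rw [hre]
    rw [integral_add (hYb.integrable.const_mul _) (integrable_const _), integral_const_mul, hEY]
    simp
    ring
  calc _ ≤ ∫⁻ ω, ENNReal.ofReal (1 + θ * (Y ω - ‖v‖ ^ 2) +
        θ ^ 2 * (b * Y ω - 2 * ‖v‖ ^ 2 * Y ω + ‖v‖ ^ 4)) ∂μ :=
        lintegral_mono fun ω => ENNReal.ofReal_le_ofReal (hpt ω)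
    _ = ENNReal.ofReal (1 + θ ^ 2 * (b * ‖v‖ ^ 2 - ‖v‖ ^ 4)) := by
        rw [← ofReal_integral_eq_lintegral_ofReal hR.integrable
          (Filter.Eventually.of_forall fun ω => (Real.exp_pos _).le.trans (hpt ω)), hint]
    _ ≤ _ := by
        refine ENNReal.ofReal_le_ofReal ?_
        have h1 := Real.add_one_le_exp (θ ^ 2 * b)
        have h2 : b * ‖v‖ ^ 2 - ‖v‖ ^ 4 ≤ b := by nlinarith [sq_nonneg (‖v‖ ^ 2)]
        have h3 := mul_le_mul_of_nonneg_left h2 (sq_nonneg θ)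
        linarith

lemma dependsOn_inner_feature (v : EuclideanSpace ℝ (Fin p × (Fin L × Fin p))) (t : ℕ) :
    DependsOn (fun x : ℕ → EuclideanSpace ℝ (Fin p) => ⟪v, feature L x t⟫)
      (Finset.Icc (t - L) t : Set ℕ) := fun x y hxy => by
  simp only [inner_feature]
  refine Finset.sum_congr rfl fun q _ => ?_
  have := q.2.1.2
  rw [hxy t (by simp), hxy (t - 1 - q.2.1) (by simp; omega)]

/-- Two-sided deviation bound for the quadratic form of the empirical covariance. -/
lemma measure_abs_sum_feature_le [IsProbabilityMeasure μ] (hu : RegularInputs μ T u β)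
    {v : EuclideanSpace ℝ (Fin p × (Fin L × Fin p))} (hv : ‖v‖ ≤ 1) (hb : 1 ≤ β ^ 4 * L)
    (hT : (L : ℝ) + 1 ≤ (T : ℝ) - L) :
    μ {ω | ((T : ℝ) - L) / 4 < |∑ t ∈ Finset.Icc (L + 1) T, ⟪v, feature L (fun r => u r ω) t⟫ ^ 2 -
      ((T : ℝ) - L) * ‖v‖ ^ 2|} ≤
      ENNReal.ofReal (2 * Real.exp (-(((T : ℝ) - L) / (128 * (β ^ 4 * L * (L + 1)))))) := by
  set b : ℝ := β ^ 4 * L with hbdef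
  set N : ℝ := (T : ℝ) - L with hN
  have hLpos : (0 : ℝ) < L + 1 := by positivity
  have hbpos : 0 < b := by linarith
  have hLT : L ≤ T := by
    have : (L : ℝ) ≤ T := by linarith
    exact_mod_cast this
  have hpath : ∀ t, Measurable fun x : ℕ → EuclideanSpace ℝ (Fin p) => ⟪v, feature L x t⟫ :=
    fun t => by
      simp_rw [inner_feature]
      fun_prop
  have key : ∀ σ : ℝ, |σ| = 1 → μ {ω | N / 4 ≤ ∑ t ∈ Finset.Icc (L + 1) T,
      σ * (⟪v, feature L (fun r => u r ω) t⟫ ^ 2 - ‖v‖ ^ 2)} ≤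
      ENNReal.ofReal (Real.exp (-(N / (128 * (b * (L + 1)))))) := fun σ hσ => by
    have hσ2 : σ ^ 2 = 1 := by rw [← sq_abs, hσ, one_pow]
    have h := measure_sum_ge_le (L := L) hu.meas hu.indep
      (Z := fun t x => σ * (⟪v, feature L x t⟫ ^ 2 - ‖v‖ ^ 2))
      (fun t => by have := hpath t; fun_prop)
      (fun t x y hxy => by
        have := dependsOn_inner_feature v t hxy
        simp only at this ⊢
        rw [this])
      (θ := 1 / (16 * b)) (κ := 1 / (256 * b)) (by positivity) (by positivity) hLT
      (fun t ht => by
        have h1 := hu.integral_exp_feature_le ht hv hb (θ := 1 / (16 * b) * σ) (by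
          rw [abs_mul, hσ, mul_one, abs_of_pos (by positivity), ← hbdef]
          field_simp
          norm_num)
        convert! h1 using 3
        · rw [mul_assoc]
        · rw [mul_pow, hσ2, ← hbdef]
          field_simp
          norm_num) (N / 4)
    refine h.trans (ENNReal.ofReal_le_ofReal (Real.exp_le_exp.2 ?_))
    rw [← hN]
    -- Each class has at most 2N/(L + 1) times. In units of N/(b(L + 1)) the exponent is then at
    -- most 2/256 - 1/64 = -1/128.
    have h1 : 1 ≤ N / (L + 1) := (one_le_div hLpos).2 hT
    have h2 : 1 / (256 * b) * (N / (L + 1) + 1) ≤ 1 / (256 * b) * (2 * (N / (L + 1))) :=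
      mul_le_mul_of_nonneg_left (by linarith) (by positivity)
    refine (sub_le_sub_right h2 _).trans (le_of_eq ?_)
    field_simp
    ring
  have hcard : ((Finset.Icc (L + 1) T).card : ℝ) = N := by
    rw [Nat.card_Icc, hN, Nat.cast_sub (by omega)]
    push_cast
    ring
  have hsub : {ω | N / 4 < |∑ t ∈ Finset.Icc (L + 1) T, ⟪v, feature L (fun r => u r ω) t⟫ ^ 2 -
      N * ‖v‖ ^ 2|} ⊆
      {ω | N / 4 ≤ ∑ t ∈ Finset.Icc (L + 1) T,
        (1 : ℝ) * (⟪v, feature L (fun r => u r ω) t⟫ ^ 2 - ‖v‖ ^ 2)} ∪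
      {ω | N / 4 ≤ ∑ t ∈ Finset.Icc (L + 1) T,
        (-1 : ℝ) * (⟪v, feature L (fun r => u r ω) t⟫ ^ 2 - ‖v‖ ^ 2)} := fun ω hω => by
    simp only [Set.mem_union, Set.mem_ofPred_eq, ← Finset.mul_sum, Finset.sum_sub_distrib,
      Finset.sum_const, nsmul_eq_mul, hcard] at hω ⊢
    rcases lt_abs.1 hω with h | h
    · left; linarith
    · right; linarith
  refine (measure_mono hsub).trans ((measure_union_le _ _).trans ?_)
  refine (add_le_add (key 1 (by simp)) (key (-1) (by simp))).trans (le_of_eq ?_)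
  rw [← ENNReal.ofReal_add (Real.exp_pos _).le (Real.exp_pos _).le, two_mul]

/-- With high probability the empirical covariance of the regressors is bounded below. -/
lemma measure_not_excited_le [IsProbabilityMeasure μ] (hu : RegularInputs μ T u β) (hL : 1 ≤ L)
    (hp : 1 ≤ p) {δ : ℝ} (hδ : 0 < δ) (hδ1 : δ < 1)
    (hT : 640 * (β ^ 4 * L * (L + 1) * (Real.log (2 * (L + 1) / δ) + p ^ 2 * L)) ≤ (T : ℝ) - L) :
    μ {ω | ¬ ∀ v : EuclideanSpace ℝ (Fin p × (Fin L × Fin p)), ((T : ℝ) - L) / 4 * ‖v‖ ^ 2 ≤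
      ∑ t ∈ Finset.Icc (L + 1) T, ⟪v, feature L (fun r => u r ω) t⟫ ^ 2} ≤
      ENNReal.ofReal (δ / 2) := by
  obtain ⟨s, hs, hcard, hnet⟩ :=
    exists_eighth_net (E := EuclideanSpace ℝ (Fin p × (Fin L × Fin p)))
  set N : ℝ := (T : ℝ) - L with hN
  have hL' : (1 : ℝ) ≤ L := by exact_mod_cast hL
  have hp' : (1 : ℝ) ≤ p := by exact_mod_cast hp
  have hβ : 1 ≤ β ^ 4 := by
    have := hu.one_le_sq hp
    nlinarith
  have hb : 1 ≤ β ^ 4 * L := by nlinarith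
  set b : ℝ := β ^ 4 * L with hbdef
  set ℓ : ℝ := Real.log (2 * (L + 1) / δ) with hℓ
  set d : ℕ := p ^ 2 * L with hd
  have hratio : 1 ≤ 2 * ((L : ℝ) + 1) / δ := by
    rw [one_le_div hδ]
    linarith
  have hℓ0 : 0 ≤ ℓ := Real.log_nonneg hratio
  have hd1 : (1 : ℝ) ≤ p ^ 2 * L := by nlinarith
  have hTL : (L : ℝ) + 1 ≤ N := by
    have h1 : (1 : ℝ) ≤ ℓ + p ^ 2 * L := by linarith
    have h2 : (L : ℝ) + 1 ≤ b * (L + 1) := le_mul_of_one_le_left (by positivity) hb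
    have h3 : b * (L + 1) ≤ b * (L + 1) * (ℓ + p ^ 2 * L) :=
      le_mul_of_one_le_right (by positivity) h1
    linarith
  have hN0 : 0 ≤ N := by linarith
  have hsub : {ω | ¬ ∀ v : EuclideanSpace ℝ (Fin p × (Fin L × Fin p)), N / 4 * ‖v‖ ^ 2 ≤
      ∑ t ∈ Finset.Icc (L + 1) T, ⟪v, feature L (fun r => u r ω) t⟫ ^ 2} ⊆
      ⋃ c ∈ s, {ω | N / 4 < |∑ t ∈ Finset.Icc (L + 1) T,
        ⟪c, feature L (fun r => u r ω) t⟫ ^ 2 - N * ‖c‖ ^ 2|} := fun ω hω => by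
    by_contra hcon
    simp only [Set.mem_iUnion, Set.mem_ofPred_eq, not_exists, not_lt] at hcon
    exact hω fun v => le_sum_inner_sq_of_net _ _ hN0 s hs hnet hcon v
  refine (measure_mono hsub).trans ((measure_biUnion_finset_le _ _).trans ?_)
  refine (Finset.sum_le_sum fun c hc => hu.measure_abs_sum_feature_le (hs c hc) hb hTL).trans ?_
  rw [Finset.sum_const, nsmul_eq_mul, ← ENNReal.ofReal_natCast,
    ← ENNReal.ofReal_mul (Nat.cast_nonneg _)]
  refine ENNReal.ofReal_le_ofReal ?_
  rw [← hbdef, ← hN]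
  -- 640 = 5 · 128. The factor 5 is chosen so that e⁵ exceeds the base 17 of the net size.
  have hexp : 5 * (ℓ + d) ≤ N / (128 * (b * (L + 1))) := by
    rw [le_div_iff₀ (by positivity)]
    refine le_trans (le_of_eq ?_) hT
    rw [hd]
    push_cast
    ring
  have hfin : Module.finrank ℝ (EuclideanSpace ℝ (Fin p × (Fin L × Fin p))) = d := by
    rw [finrank_euclideanSpace]
    simp [hd]
    ring
  rw [hfin] at hcard
  have h17 : (17 : ℝ) ≤ Real.exp 5 := by
    have := Real.add_one_le_exp (1 : ℝ)
    have h2 : Real.exp 5 = Real.exp 1 ^ 5 := by rw [← Real.exp_nat_mul]; norm_num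
    rw [h2]
    calc (17 : ℝ) ≤ 2 ^ 5 := by norm_num
      _ ≤ Real.exp 1 ^ 5 := by gcongr; linarith
  have hexpℓ : Real.exp (-ℓ) = δ / (2 * (L + 1)) := by
    rw [Real.exp_neg, hℓ, Real.exp_log (by positivity), inv_div]
  calc (s.card : ℝ) * (2 * Real.exp (-(N / (128 * (b * (L + 1))))))
      ≤ Real.exp 5 ^ d * (2 * Real.exp (-(5 * (ℓ + d)))) := by
        gcongr
        calc (s.card : ℝ) ≤ ((17 ^ d : ℕ) : ℝ) := by exact_mod_cast hcard
          _ = (17 : ℝ) ^ d := by push_cast; rfl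
          _ ≤ _ := by gcongr
    _ = 2 * Real.exp (-(5 * ℓ)) := by
        rw [← Real.exp_nat_mul, mul_left_comm, ← Real.exp_add]
        congr 2
        ring
    _ ≤ 2 * Real.exp (-ℓ) := by gcongr; linarith
    _ ≤ δ / 2 := by
        rw [hexpℓ, mul_div_assoc', div_le_div_iff₀ (by positivity) (by norm_num)]
        nlinarith

end RegularInputs

end BilinearObs

/-! ### Spectral and Frobenius norms -/

namespace BilinearObs

open scoped RealInnerProductSpace

section SpectralNorm

open scoped Matrix.Norms.L2Operator

variable {ι κ τ : Type} [Fintype ι] [Fintype κ] [DecidableEq κ] [Fintype τ] [DecidableEq τ]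

lemma specNorm_nonneg (M : Matrix ι κ ℝ) : 0 ≤ specNorm M := norm_nonneg M

lemma specNorm_mul_le (M : Matrix ι κ ℝ) (N : Matrix κ τ ℝ) :
    specNorm (M * N) ≤ specNorm M * specNorm N := Matrix.l2_opNorm_mul M N

lemma specNorm_transpose [DecidableEq ι] (M : Matrix ι κ ℝ) : specNorm Mᵀ = specNorm M := by
  have := Matrix.l2_opNorm_conjTranspose M
  rwa [Matrix.conjTranspose_eq_transpose_of_trivial] at this

lemma norm_mulVec_le (M : Matrix ι κ ℝ) (x : κ → ℝ) :
    ‖(WithLp.toLp 2 (M *ᵥ x) : EuclideanSpace ℝ ι)‖ ≤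
      specNorm M * ‖(WithLp.toLp 2 x : EuclideanSpace ℝ κ)‖ :=
  Matrix.l2_opNorm_mulVec M (WithLp.toLp 2 x)

lemma dotProduct_eq_inner (x y : ι → ℝ) :
    x ⬝ᵥ y = ⟪(WithLp.toLp 2 x : EuclideanSpace ℝ ι), WithLp.toLp 2 y⟫ := by
  simp [PiLp.inner_apply, dotProduct, mul_comm]

lemma norm_sq_eq_dotProduct (x : ι → ℝ) :
    ‖(WithLp.toLp 2 x : EuclideanSpace ℝ ι)‖ ^ 2 = x ⬝ᵥ x := by
  rw [dotProduct_eq_inner, real_inner_self_eq_norm_sq]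

lemma abs_dotProduct_mulVec_le (x : ι → ℝ) (M : Matrix ι κ ℝ) (y : κ → ℝ) :
    |x ⬝ᵥ (M *ᵥ y)| ≤ specNorm M * (‖(WithLp.toLp 2 x : EuclideanSpace ℝ ι)‖ *
      ‖(WithLp.toLp 2 y : EuclideanSpace ℝ κ)‖) := by
  rw [dotProduct_eq_inner]
  refine (abs_real_inner_le_norm _ _).trans ?_
  calc _ ≤ ‖(WithLp.toLp 2 x : EuclideanSpace ℝ ι)‖ *
        (specNorm M * ‖(WithLp.toLp 2 y : EuclideanSpace ℝ κ)‖) := by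
        gcongr
        exact norm_mulVec_le M y
    _ = _ := by ring

/-- Applying M to its own i-th row r produces ‖r‖² as i-th entry, so ‖r‖² ≤ ‖M‖‖r‖. -/
lemma row_dotProduct_self_le (M : Matrix ι κ ℝ) (i : ι) :
    M.row i ⬝ᵥ M.row i ≤ specNorm M ^ 2 := by
  set v : EuclideanSpace ℝ κ := WithLp.toLp 2 (M.row i) with hv
  have h1 : ‖v‖ ^ 2 = M.row i ⬝ᵥ M.row i := norm_sq_eq_dotProduct _
  have h2 : M.row i ⬝ᵥ M.row i ≤ specNorm M * ‖v‖ :=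
    calc M.row i ⬝ᵥ M.row i = (WithLp.toLp 2 (M *ᵥ M.row i) : EuclideanSpace ℝ ι) i := rfl
      _ ≤ ‖(WithLp.toLp 2 (M *ᵥ M.row i) : EuclideanSpace ℝ ι) i‖ := le_abs_self _
      _ ≤ ‖(WithLp.toLp 2 (M *ᵥ M.row i) : EuclideanSpace ℝ ι)‖ := PiLp.norm_apply_le _ i
      _ ≤ _ := norm_mulVec_le M _
  rw [← h1] at h2 ⊢
  have h3 : ‖v‖ ≤ specNorm M := by
    by_contra! hlt
    have h4 : 0 < ‖v‖ := (specNorm_nonneg M).trans_lt hlt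
    nlinarith
  gcongr

lemma frobNorm_sq {ι κ : Type} [Fintype ι] [Fintype κ] (M : Matrix ι κ ℝ) : frobNorm M ^ 2 = ∑ i, ∑ j, M i j ^ 2 := by
  have h : frobNorm M = (∑ i, ∑ j, ‖M i j‖ ^ (2 : ℝ)) ^ (1 / 2 : ℝ) := Matrix.frobenius_norm_def M
  rw [h, ← Real.sqrt_eq_rpow, Real.sq_sqrt (by positivity)]
  simp

lemma frobNorm_nonneg {ι κ : Type} [Fintype ι] [Fintype κ] (M : Matrix ι κ ℝ) : 0 ≤ frobNorm M :=
  letI := Matrix.frobeniusNormedAddCommGroup (m := ι) (n := κ) (α := ℝ)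
  norm_nonneg M

/-- Real vectors embed isometrically in complex ones. This links the real norm to the complex
spectral radius in Gelfand's formula. -/
lemma specNorm_le_norm_map (M : Matrix ι κ ℝ) : specNorm M ≤ ‖M.map (algebraMap ℝ ℂ)‖ := by
  refine ContinuousLinearMap.opNorm_le_bound _ (norm_nonneg _) fun x => ?_
  have h1 := Matrix.l2_opNorm_mulVec (M.map (algebraMap ℝ ℂ))
    (WithLp.toLp 2 fun k => (x k : ℂ) : EuclideanSpace ℂ κ)
  have h2 : ‖(WithLp.toLp 2 fun k => (x k : ℂ) : EuclideanSpace ℂ κ)‖ = ‖x‖ := by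
    simp [EuclideanSpace.norm_eq]
  have h3 : ‖(WithLp.toLp 2 (M.map (algebraMap ℝ ℂ) *ᵥ fun k => (x k : ℂ)) :
      EuclideanSpace ℂ ι)‖ = ‖(WithLp.toLp 2 (M *ᵥ x.ofLp) : EuclideanSpace ℝ ι)‖ := by
    rw [EuclideanSpace.norm_eq, EuclideanSpace.norm_eq]
    congr 1
    refine Finset.sum_congr rfl fun i _ => ?_
    congr 1
    have : (M.map (algebraMap ℝ ℂ) *ᵥ fun k => (x k : ℂ)) i = (((M *ᵥ x.ofLp) i : ℝ) : ℂ) := by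
      simp [Matrix.mulVec, dotProduct]
    simp only [this, Complex.norm_real]
  rw [h2] at h1
  exact h3 ▸ h1

end SpectralNorm

/-! ### Stability: the transient constant and the Gramian -/

section Stability

open scoped Matrix.Norms.L2Operator

variable {n : ℕ} {A : Matrix (Fin n) (Fin n) ℝ} {ρ : ℝ}

lemma rho_pos (h : specRadius A < ENNReal.ofReal ρ) : 0 < ρ :=
  ENNReal.ofReal_pos.1 (pos_of_gt h)

/-- By Gelfand's formula the ratio is eventually at most 1; a finite sum covers the remaining k.
Boundedness is essential, since an unbounded real supremum defaults to 0. -/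
lemma bddAbove_transient (h : specRadius A < ENNReal.ofReal ρ) :
    BddAbove (Set.range fun k : ℕ => specNorm (A ^ k) / ρ ^ k) := by
  have hρ := rho_pos h
  have hg := spectrum.pow_norm_pow_one_div_tendsto_nhds_spectralRadius (A.map (algebraMap ℝ ℂ))
  have hev := (hg.eventually (gt_mem_nhds h)).and (Filter.eventually_ge_atTop 1)
  have hev' : ∀ᶠ k : ℕ in Filter.atTop, specNorm (A ^ k) / ρ ^ k ≤ 1 := by
    filter_upwards [hev] with k hk
    obtain ⟨hk, hk1⟩ := hk
    rw [div_le_one (by positivity)]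
    have h1 : specNorm (A ^ k) ≤ ‖(A.map (algebraMap ℝ ℂ)) ^ k‖ := by
      have := specNorm_le_norm_map (A ^ k)
      have h2 : (A ^ k).map (algebraMap ℝ ℂ) = (A.map (algebraMap ℝ ℂ)) ^ k :=
        map_pow (algebraMap ℝ ℂ).mapMatrix A k
      rwa [h2] at this
    refine h1.trans ?_
    have h3 := (ENNReal.ofReal_lt_ofReal_iff hρ).1 hk
    have h4 : (0 : ℝ) < k := by exact_mod_cast hk1
    calc ‖(A.map (algebraMap ℝ ℂ)) ^ k‖
        = (‖(A.map (algebraMap ℝ ℂ)) ^ k‖ ^ (1 / k : ℝ)) ^ k := by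
          rw [← Real.rpow_natCast, ← Real.rpow_mul (norm_nonneg _), one_div,
            inv_mul_cancel₀ h4.ne', Real.rpow_one]
      _ ≤ ρ ^ k := by gcongr
  obtain ⟨k₀, hk₀⟩ := Filter.eventually_atTop.1 hev'
  refine ⟨1 + ∑ k ∈ Finset.range k₀, specNorm (A ^ k) / ρ ^ k, ?_⟩
  rintro _ ⟨k, rfl⟩
  have hpos : ∀ k, 0 ≤ specNorm (A ^ k) / ρ ^ k := fun k =>
    div_nonneg (specNorm_nonneg _) (by positivity)
  by_cases hk : k < k₀
  · have := Finset.single_le_sum (fun j _ => hpos j) (Finset.mem_range.2 hk)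
    simp only at this ⊢
    linarith
  · have h1 := hk₀ k (not_lt.1 hk)
    have h2 := Finset.sum_nonneg fun j (_ : j ∈ Finset.range k₀) => hpos j
    simp only
    linarith

lemma specNorm_pow_le (h : specRadius A < ENNReal.ofReal ρ) (k : ℕ) :
    specNorm (A ^ k) ≤ transient A ρ * ρ ^ k := by
  have hρ := rho_pos h
  rw [← div_le_iff₀ (by positivity)]
  exact le_ciSup (bddAbove_transient h) k

lemma transient_nonneg (h : specRadius A < ENNReal.ofReal ρ) : 0 ≤ transient A ρ := by
  have := (specNorm_nonneg _).trans (specNorm_pow_le h 0)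
  simpa using this

/-- Replaces 1 ≤ φ(A, ρ), which fails for n = 0, where φ = 0. It follows from M = A⁰M. -/
lemma specNorm_le_transient_mul {m : ℕ} (h : specRadius A < ENNReal.ofReal ρ)
    (M : Matrix (Fin n) (Fin m) ℝ) : specNorm M ≤ transient A ρ * specNorm M := by
  have h1 := specNorm_mul_le (A ^ 0) M
  have h2 := specNorm_pow_le h 0
  rw [pow_zero, Matrix.one_mul] at h1
  rw [pow_zero, pow_zero, mul_one] at h2
  exact h1.trans (mul_le_mul_of_nonneg_right h2 (specNorm_nonneg _))

lemma hasSum_gramian (h : specRadius A < ENNReal.ofReal ρ) (hρ1 : ρ < 1)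
    (Sw : Matrix (Fin n) (Fin n) ℝ) :
    HasSum (fun i : ℕ => A ^ i * Sw * (A ^ i)ᵀ) (gramian A Sw) := by
  refine Summable.hasSum ?_
  have hρ := rho_pos h
  have hgeo := (summable_geometric_of_lt_one hρ.le hρ1).mul_left
    (transient A ρ * specNorm Sw * transient A ρ)
  refine Summable.of_norm_bounded hgeo fun i => ?_
  change specNorm (A ^ i * Sw * (A ^ i)ᵀ) ≤ _
  have h1 := specNorm_pow_le h i
  have hφ := transient_nonneg h
  have h2 : specNorm (A ^ i) ≤ transient A ρ :=
    h1.trans (mul_le_of_le_one_right hφ (pow_le_one₀ hρ.le hρ1.le))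
  calc _ ≤ specNorm (A ^ i) * specNorm Sw * specNorm (A ^ i) := by
        refine (specNorm_mul_le _ _).trans ?_
        rw [specNorm_transpose]
        exact mul_le_mul_of_nonneg_right (specNorm_mul_le _ _) (specNorm_nonneg _)
    _ ≤ (transient A ρ * ρ ^ i) * specNorm Sw * transient A ρ := by
        have := specNorm_nonneg (A ^ i)
        have := specNorm_nonneg Sw
        gcongr
    _ = _ := by ring

lemma dotProduct_transpose_mulVec (M S : Matrix (Fin n) (Fin n) ℝ) (v : Fin n → ℝ) :
    v ⬝ᵥ ((M * S * Mᵀ) *ᵥ v) = (v ᵥ* M) ⬝ᵥ (S *ᵥ (v ᵥ* M)) := by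
  rw [← Matrix.mulVec_mulVec, ← Matrix.mulVec_mulVec, Matrix.mulVec_transpose,
    Matrix.dotProduct_mulVec]

/-- The noise energy seen through `C` over a finite horizon. -/
lemma sum_quadratic_le {p L t : ℕ} (h : specRadius A < ENNReal.ofReal ρ) (hρ1 : ρ < 1)
    (C : Matrix (Fin p) (Fin n) ℝ) {Sw : Matrix (Fin n) (Fin n) ℝ}
    (hSw : ∀ v, 0 ≤ v ⬝ᵥ (Sw *ᵥ v)) (hLt : L ≤ t) :
    ∑ i ∈ Finset.range t, ∑ r, (C * A ^ i).row r ⬝ᵥ (Sw *ᵥ (C * A ^ i).row r) ≤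
      sigmaWSq L A C Sw ρ + p * sigmaESq L A C Sw ρ := by
  have hρ := rho_pos h
  have hφ := transient_nonneg h
  rw [← Finset.sum_range_add_sum_Ico _ hLt]
  refine add_le_add ?_ ?_
  · have h1 : ∑ i ∈ Finset.range L, ∑ r, (C * A ^ i).row r ⬝ᵥ (Sw *ᵥ (C * A ^ i).row r) ≤
        specNorm Sw * frobNorm (noiseMarkov L A C) ^ 2 := by
      rw [frobNorm_sq, Finset.sum_comm, Finset.mul_sum]
      refine Finset.sum_le_sum fun r _ => ?_
      rw [Fintype.sum_prod_type, Finset.sum_range, Finset.mul_sum]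
      refine Finset.sum_le_sum fun i _ => ?_
      refine (le_abs_self _).trans ((abs_dotProduct_mulVec_le _ _ _).trans (le_of_eq ?_))
      rw [← pow_two, norm_sq_eq_dotProduct]
      simp [dotProduct, noiseMarkov, pow_two]
    refine h1.trans (le_mul_of_one_le_right
      (mul_nonneg (specNorm_nonneg _) (sq_nonneg _)) ?_)
    have : 0 ≤ transient A ρ * ρ ^ L / (1 - ρ) :=
      div_nonneg (by positivity) (by linarith)
    linarith
  -- Lags from L on: with v a row of CA^L the terms are a partial sum of vᵀΓv. There are p such
  -- rows, hence the factor p.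
  · have h1 : ∀ r, ∑ i ∈ Finset.Ico L t, (C * A ^ i).row r ⬝ᵥ (Sw *ᵥ (C * A ^ i).row r) ≤
        specNorm (gramian A Sw) * specNorm (C * A ^ L) ^ 2 := fun r => by
      set v := (C * A ^ L).row r with hv
      have hsum : HasSum (fun i : ℕ => v ⬝ᵥ ((A ^ i * Sw * (A ^ i)ᵀ) *ᵥ v))
          (v ⬝ᵥ (gramian A Sw *ᵥ v)) := by
        let ℓ : Matrix (Fin n) (Fin n) ℝ →+ ℝ :=
          { toFun := fun M => v ⬝ᵥ (M *ᵥ v)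
            map_zero' := by simp
            map_add' := fun M N => by simp [Matrix.add_mulVec, dotProduct_add] }
        have hℓ : Continuous ℓ := by
          change Continuous fun M : Matrix (Fin n) (Fin n) ℝ => v ⬝ᵥ (M *ᵥ v)
          fun_prop
        exact (hasSum_gramian h hρ1 Sw).map ℓ hℓ
      have hrow : ∀ i, (C * A ^ (L + i)).row r = v ᵥ* A ^ i := fun i => by
        rw [pow_add, ← Matrix.mul_assoc]
        rfl
      rw [Finset.sum_Ico_eq_sum_range]
      calc _ = ∑ i ∈ Finset.range (t - L), v ⬝ᵥ ((A ^ i * Sw * (A ^ i)ᵀ) *ᵥ v) :=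
            Finset.sum_congr rfl fun i _ => by rw [dotProduct_transpose_mulVec, hrow]
        _ ≤ v ⬝ᵥ (gramian A Sw *ᵥ v) := sum_le_hasSum _
            (fun i _ => by rw [dotProduct_transpose_mulVec]; exact hSw _) hsum
        _ ≤ specNorm (gramian A Sw) * (v ⬝ᵥ v) := by
            refine (le_abs_self _).trans ((abs_dotProduct_mulVec_le _ _ _).trans (le_of_eq ?_))
            rw [← pow_two, norm_sq_eq_dotProduct]
        _ ≤ _ := mul_le_mul_of_nonneg_left (row_dotProduct_self_le _ _) (specNorm_nonneg _)
    rw [Finset.sum_comm]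
    refine (Finset.sum_le_sum fun r _ => h1 r).trans ?_
    simp only [Finset.sum_const, Finset.card_univ, Fintype.card_fin, nsmul_eq_mul]
    refine mul_le_mul_of_nonneg_left ?_ (Nat.cast_nonneg p)
    rw [sigmaESq]
    have h2 := specNorm_le_transient_mul h (gramian A Sw)
    have h3 : transient A ρ ≤ transient A ρ / (1 - ρ) := by
      rw [le_div_iff₀ (by linarith)]
      nlinarith
    have h4 : specNorm (gramian A Sw) ≤ specNorm (gramian A Sw) * (transient A ρ / (1 - ρ)) := by
      rw [mul_comm] at h2
      exact h2.trans (mul_le_mul_of_nonneg_left h3 (specNorm_nonneg _))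
    have h5 := mul_le_mul_of_nonneg_right h4 (sq_nonneg (specNorm (C * A ^ L)))
    linarith

end Stability

end BilinearObs

/-! ### The output as a linear regression, and its truncation bias -/

namespace BilinearObs

open scoped RealInnerProductSpace

/-- The vectorisation of a coefficient matrix, as an element of a Euclidean space. -/
noncomputable def vecMat {p L : ℕ} (M : Matrix (Fin p) (Fin L × Fin p) ℝ) :
    EuclideanSpace ℝ (Fin p × (Fin L × Fin p)) :=
  WithLp.toLp 2 fun q => M q.1 q.2

/-- The contribution of the process noise to `C x_t`. -/
noncomputable def noiseState {n p : ℕ} (A : Matrix (Fin n) (Fin n) ℝ)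
    (C : Matrix (Fin p) (Fin n) ℝ) (w : ℕ → EuclideanSpace ℝ (Fin n)) (t : ℕ) :
    EuclideanSpace ℝ (Fin p) :=
  WithLp.toLp 2 (∑ i ∈ Finset.range t, (C * A ^ i) *ᵥ (w (t - 1 - i)).ofLp)

/-- The contribution to `y_t` of the inputs that are more than `L` steps old. -/
noncomputable def tailBias {n p : ℕ} (L : ℕ) (A : Matrix (Fin n) (Fin n) ℝ)
    (B : Matrix (Fin n) (Fin p) ℝ) (C : Matrix (Fin p) (Fin n) ℝ)
    (u : ℕ → EuclideanSpace ℝ (Fin p)) (t : ℕ) : ℝ :=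
  ∑ i ∈ Finset.Ico L t, (u t).ofLp ⬝ᵥ ((C * A ^ i * B) *ᵥ (u (t - 1 - i)).ofLp)

variable {n p L T t : ℕ} {A : Matrix (Fin n) (Fin n) ℝ} {B : Matrix (Fin n) (Fin p) ℝ}
  {C : Matrix (Fin p) (Fin n) ℝ}

lemma norm_vecMat (M : Matrix (Fin p) (Fin L × Fin p) ℝ) : ‖vecMat M‖ = frobNorm M := by
  refine (pow_left_inj₀ (norm_nonneg _) (frobNorm_nonneg M) two_ne_zero).1 ?_
  rw [frobNorm_sq, EuclideanSpace.real_norm_sq_eq, Fintype.sum_prod_type]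
  rfl

lemma vecMat_sub (M N : Matrix (Fin p) (Fin L × Fin p) ℝ) :
    vecMat (M - N) = vecMat M - vecMat N := rfl

lemma dotProduct_mulVec_lagged (M : Matrix (Fin p) (Fin L × Fin p) ℝ)
    (u : ℕ → EuclideanSpace ℝ (Fin p)) (t : ℕ) :
    (u t).ofLp ⬝ᵥ (M *ᵥ lagged L u (t - 1)) = ⟪vecMat M, feature L u t⟫ := by
  rw [inner_feature, Fintype.sum_prod_type, dotProduct]
  refine Finset.sum_congr rfl fun i _ => ?_
  rw [Matrix.mulVec, dotProduct, Finset.mul_sum]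
  refine Finset.sum_congr rfl fun q _ => ?_
  simp only [lagged, vecMat]
  ring

lemma state_eq_sum (u : ℕ → EuclideanSpace ℝ (Fin p)) (w : ℕ → EuclideanSpace ℝ (Fin n)) (t : ℕ) :
    state A B u w t = ∑ i ∈ Finset.range t,
      A ^ i *ᵥ (B *ᵥ (u (t - 1 - i)).ofLp + (w (t - 1 - i)).ofLp) := by
  induction t with
  | zero => simp [state]
  | succ t ih =>
    rw [state, ih, Finset.sum_range_succ', Matrix.mulVec_sum, add_assoc]
    congr 1
    · refine Finset.sum_congr rfl fun i _ => ?_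
      rw [Matrix.mulVec_mulVec, ← pow_succ', show t + 1 - 1 - (i + 1) = t - 1 - i by omega]
    · simp

/-- The unrolled state splits by source and lag: inputs of lag index below L give the Markov term,
older ones the bias, and the process noise gives h_t. -/
lemma output_eq (u : ℕ → EuclideanSpace ℝ (Fin p)) (w : ℕ → EuclideanSpace ℝ (Fin n))
    (z : ℕ → ℝ) (hLt : L ≤ t) :
    output A B C u w z t = ⟪vecMat (markov L A B C), feature L u t⟫ +
      (z t + ⟪noiseState A C w t, u t⟫ + tailBias L A B C u t) := by
  have h1 : C *ᵥ state A B u w t =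
      ∑ i ∈ Finset.range t, (C * A ^ i * B) *ᵥ (u (t - 1 - i)).ofLp + (noiseState A C w t).ofLp := by
    rw [state_eq_sum, Matrix.mulVec_sum, noiseState, ← Finset.sum_add_distrib]
    refine Finset.sum_congr rfl fun i _ => ?_
    rw [Matrix.mulVec_mulVec, Matrix.mulVec_add, Matrix.mulVec_mulVec]
  have h2 : (u t).ofLp ⬝ᵥ (noiseState A C w t).ofLp = ⟪noiseState A C w t, u t⟫ := by
    rw [real_inner_comm, dotProduct_eq_inner]
  have h3 : ∑ i ∈ Finset.range L, (u t).ofLp ⬝ᵥ ((C * A ^ i * B) *ᵥ (u (t - 1 - i)).ofLp) =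
      ⟪vecMat (markov L A B C), feature L u t⟫ := by
    rw [← dotProduct_mulVec_lagged, Finset.sum_range, ← dotProduct_sum]
    congr 1
    ext r
    rw [Finset.sum_apply, Matrix.mulVec, dotProduct, Fintype.sum_prod_type]
    rfl
  rw [output, h1, dotProduct_add, h2, dotProduct_sum, ← Finset.sum_range_add_sum_Ico _ hLt, h3,
    tailBias]
  ring

/-- ‖CA^iB‖ ≤ K²φρ^i, summed as a geometric tail. -/
lemma abs_tailBias_le {ρ β K : ℝ} (h : specRadius A < ENNReal.ofReal ρ) (hρ1 : ρ < 1)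
    (hB : specNorm B ≤ K) (hC : specNorm C ≤ K) {u : ℕ → EuclideanSpace ℝ (Fin p)}
    (hu : ∀ r ≤ t, ‖u r‖ ≤ β) :
    |tailBias L A B C u t| ≤ β ^ 2 * K ^ 2 * transient A ρ / (1 - ρ) * ρ ^ L := by
  have hρ := rho_pos h
  have hφ := transient_nonneg h
  have hβ : 0 ≤ β := (norm_nonneg _).trans (hu 0 (Nat.zero_le _))
  have hK : 0 ≤ K := (specNorm_nonneg B).trans hB
  have hterm : ∀ i ∈ Finset.Ico L t, |(u t).ofLp ⬝ᵥ ((C * A ^ i * B) *ᵥ (u (t - 1 - i)).ofLp)| ≤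
      β ^ 2 * K ^ 2 * transient A ρ * ρ ^ i := fun i _ => by
    refine (abs_dotProduct_mulVec_le _ _ _).trans ?_
    have h1 : specNorm (C * A ^ i * B) ≤ K * (transient A ρ * ρ ^ i) * K := by
      refine (specNorm_mul_le _ _).trans
        (mul_le_mul ((specNorm_mul_le _ _).trans ?_) hB (specNorm_nonneg _) (by positivity))
      exact mul_le_mul hC (specNorm_pow_le h i) (specNorm_nonneg _) hK
    have h2 : ‖u t‖ * ‖u (t - 1 - i)‖ ≤ β * β :=
      mul_le_mul (hu t le_rfl) (hu _ (by omega)) (norm_nonneg _) hβ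
    refine (mul_le_mul h1 h2 (by positivity) (by positivity)).trans (le_of_eq ?_)
    ring
  refine (Finset.abs_sum_le_sum_abs _ _).trans ((Finset.sum_le_sum hterm).trans ?_)
  rw [← Finset.mul_sum]
  have hgeo : ∑ i ∈ Finset.Ico L t, ρ ^ i ≤ ρ ^ L / (1 - ρ) :=
    geom_sum_Ico_le_of_lt_one hρ.le hρ1
  calc _ ≤ β ^ 2 * K ^ 2 * transient A ρ * (ρ ^ L / (1 - ρ)) :=
        mul_le_mul_of_nonneg_left hgeo (by positivity)
    _ = _ := by ring

/-- Exponentiating the hypothesis gives (Nδ/D) c² ρ^{2L} ≤ 1; since c = 2g, the factor 1/4 appears.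
-/
lemma bias_sq_le_of_log_le {ρ g c N δ D : ℝ} (hρ : 0 < ρ) (hρ1 : ρ < 1) (hN : 0 < N) (hδ : 0 < δ)
    (hD : 0 < D) (hg : 0 < g) (hgc : 2 * g = c)
    (h : 1 / Real.log ρ⁻¹ * (1 / 2 * Real.log (N * δ / D) + Real.log c) ≤ L) :
    (g * ρ ^ L) ^ 2 ≤ D / (4 * (δ * N)) := by
  have hlog : 0 < Real.log ρ⁻¹ := Real.log_pos ((one_lt_inv₀ hρ).2 hρ1)
  have hc : 0 < c := by linarith
  rw [one_div, inv_mul_le_iff₀ hlog, Real.log_inv] at h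
  have ha : 0 < N * δ / D := by positivity
  have h1 : Real.log (N * δ / D * (c ^ 2 * (ρ ^ L) ^ 2)) ≤ 0 := by
    rw [Real.log_mul ha.ne' (by positivity), Real.log_mul (by positivity) (by positivity),
      Real.log_pow, Real.log_pow, Real.log_pow]
    push_cast
    linarith
  have h2 := (Real.log_nonpos_iff (by positivity)).1 h1
  rw [div_mul_eq_mul_div, div_le_one hD, ← hgc] at h2
  rw [le_div_iff₀ (by positivity)]
  linarith

/-! ### Second moments of the process noise -/

section ProcessNoise

variable {Ω : Type*} [MeasurableSpace Ω] {μ : Measure Ω}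
  {w : ℕ → Ω → EuclideanSpace ℝ (Fin n)} {z : ℕ → Ω → ℝ} {Sw : Matrix (Fin n) (Fin n) ℝ} {σz : ℝ}

namespace NoiseAssumption

lemma memLp_inner (h : NoiseAssumption μ T w z Sw σz) (ht : t ≤ T) (a : EuclideanSpace ℝ (Fin n)) :
    MemLp (fun ω => ⟪a, w t ω⟫) 2 μ := (h.memLp_w t ht).const_inner a

lemma integral_inner_sq (h : NoiseAssumption μ T w z Sw σz) (ht : t ≤ T)
    (a : EuclideanSpace ℝ (Fin n)) :
    ∫ ω, ⟪a, w t ω⟫ ^ 2 ∂μ = a.ofLp ⬝ᵥ (Sw *ᵥ a.ofLp) := by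
  have hcoord : ∀ k, MemLp (fun ω => w t ω k) 2 μ := fun k => by
    have := h.memLp_inner ht (EuclideanSpace.single k 1)
    simpa [EuclideanSpace.inner_single_left] using this
  have h1 : ∀ ω, ⟪a, w t ω⟫ ^ 2 = ∑ k, ∑ l, a k * a l * (w t ω k * w t ω l) := fun ω => by
    rw [PiLp.inner_apply, pow_two, Finset.sum_mul_sum]
    refine Finset.sum_congr rfl fun i _ => Finset.sum_congr rfl fun j _ => ?_
    simp
    ring
  have hb : ∀ k l, Integrable (fun ω => a k * a l * (w t ω k * w t ω l)) μ := fun k l =>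
    ((hcoord k).integrable_mul (hcoord l)).const_mul _
  simp_rw [h1]
  rw [integral_finsetSum _ fun k _ => integrable_finsetSum _ fun l _ => hb k l]
  refine Finset.sum_congr rfl fun k _ => ?_
  rw [integral_finsetSum _ fun l _ => hb k l, Matrix.mulVec, dotProduct, Finset.mul_sum]
  refine Finset.sum_congr rfl fun l _ => ?_
  rw [integral_const_mul, h.cov_w t ht]
  ring

lemma quadratic_nonneg (h : NoiseAssumption μ T w z Sw σz) (v : Fin n → ℝ) :
    0 ≤ v ⬝ᵥ (Sw *ᵥ v) := by
  have := h.integral_inner_sq (Nat.zero_le T) (WithLp.toLp 2 v)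
  rw [← this]
  exact integral_nonneg fun ω => sq_nonneg _

lemma integral_inner_mul_inner_of_ne [IsProbabilityMeasure μ] (h : NoiseAssumption μ T w z Sw σz) {s : ℕ} (hs : s ≤ T)
    (ht : t ≤ T) (hst : s ≠ t) (a b : EuclideanSpace ℝ (Fin n)) :
    ∫ ω, ⟪a, w s ω⟫ * ⟪b, w t ω⟫ ∂μ = 0 := by
  have hind : IndepFun (w s) (w t) μ :=
    h.iid_w.indep.indepFun (i := ⟨s, Nat.lt_succ_of_le hs⟩) (j := ⟨t, Nat.lt_succ_of_le ht⟩)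
      (by simpa using hst)
  have hind' : IndepFun (fun ω => ⟪a, w s ω⟫) (fun ω => ⟪b, w t ω⟫) μ :=
    hind.comp (φ := fun x => ⟪a, x⟫) (ψ := fun x => ⟪b, x⟫) (by fun_prop) (by fun_prop)
  rw [hind'.integral_fun_mul_eq_mul_integral (h.memLp_inner hs a).aestronglyMeasurable
    (h.memLp_inner ht b).aestronglyMeasurable,
    integral_inner ((h.memLp_w s hs).integrable (by norm_num)), h.mean_w s hs]
  simp

lemma noiseState_norm_sq {Ω : Type*} {w : ℕ → Ω → EuclideanSpace ℝ (Fin n)} (ω : Ω) :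
    ‖noiseState A C (fun r => w r ω) t‖ ^ 2 = ∑ r, (∑ i ∈ Finset.range t,
      ⟪(WithLp.toLp 2 ((C * A ^ i).row r) : EuclideanSpace ℝ (Fin n)), w (t - 1 - i) ω⟫) ^ 2 := by
  rw [EuclideanSpace.real_norm_sq_eq]
  refine Finset.sum_congr rfl fun r _ => ?_
  congr 1
  simp only [noiseState, Finset.sum_apply]
  exact Finset.sum_congr rfl fun i _ => dotProduct_eq_inner _ _

lemma integrable_noiseState (h : NoiseAssumption μ T w z Sw σz) (ht : t ≤ T) :
    Integrable (fun ω => ‖noiseState A C (fun r => w r ω) t‖ ^ 2) μ := by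
  simp_rw [noiseState_norm_sq]
  refine integrable_finsetSum _ fun r _ => MemLp.integrable_sq ?_
  exact memLp_finsetSum _ fun i _ => h.memLp_inner (by omega) _

/-- Noises at distinct times are uncorrelated, so each coordinate's second moment is a sum of
quadratic forms in Σ_w. -/
lemma integral_noiseState_le [IsProbabilityMeasure μ] {ρ : ℝ} (h : NoiseAssumption μ T w z Sw σz) (ht : t ≤ T)
    (hLt : L ≤ t) (hA : specRadius A < ENNReal.ofReal ρ) (hρ1 : ρ < 1) :
    ∫ ω, ‖noiseState A C (fun r => w r ω) t‖ ^ 2 ∂μ ≤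
      sigmaWSq L A C Sw ρ + p * sigmaESq L A C Sw ρ := by
  refine le_trans (le_of_eq ?_) (sum_quadratic_le hA hρ1 C h.quadratic_nonneg hLt)
  simp_rw [noiseState_norm_sq]
  rw [integral_finsetSum _ fun r _ => MemLp.integrable_sq
    (memLp_finsetSum _ fun i _ => h.memLp_inner (by omega) _), Finset.sum_comm]
  refine Finset.sum_congr rfl fun r _ => ?_
  rw [integral_sq_sum_of_orthogonal]
  · exact Finset.sum_congr rfl fun i _ => h.integral_inner_sq (by omega) _
  · exact fun i _ j _ => (h.memLp_inner (by omega) _).integrable_mul (h.memLp_inner (by omega) _)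
  · intro i hi j hj hij
    rw [Finset.mem_range] at hi hj
    exact h.integral_inner_mul_inner_of_ne (by omega) (by omega) (by omega) _ _

end NoiseAssumption

end ProcessNoise

end BilinearObs

/-! ### Freezing the noise, and passing to everywhere bounded inputs -/

namespace BilinearObs

open scoped RealInnerProductSpace

section Reduction

variable {Ω : Type*} [MeasurableSpace Ω] {μ : Measure Ω}

/-- Tonelli for the product law: a bound valid for each frozen V can be averaged over V.
Nonnegativity removes any integrability condition. -/
lemma lintegral_le_of_indepFun [IsProbabilityMeasure μ] {α γ : Type*} [MeasurableSpace α]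
    [MeasurableSpace γ] {U : Ω → α} {V : Ω → γ} (hU : Measurable U) (hV : Measurable V)
    (hUV : IndepFun U V μ) {F : α × γ → ENNReal} (hF : Measurable F) {G : γ → ENNReal}
    (hG : Measurable G) (h : ∀ v, ∫⁻ ω, F (U ω, v) ∂μ ≤ G v) :
    ∫⁻ ω, F (U ω, V ω) ∂μ ≤ ∫⁻ ω, G (V ω) ∂μ := by
  have hprod := (indepFun_iff_map_prod_eq_prod_map_map hU.aemeasurable hV.aemeasurable).1 hUV
  have := Measure.isProbabilityMeasure_map (μ := μ) hU.aemeasurable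
  have := Measure.isProbabilityMeasure_map (μ := μ) hV.aemeasurable
  calc ∫⁻ ω, F (U ω, V ω) ∂μ = ∫⁻ q, F q ∂(μ.map fun ω => (U ω, V ω)) :=
        (lintegral_map hF (hU.prodMk hV)).symm
    _ = ∫⁻ v, ∫⁻ x, F (x, v) ∂(μ.map U) ∂(μ.map V) := by
        rw [hprod, lintegral_prod_symm _ hF.aemeasurable]
    _ = ∫⁻ v, ∫⁻ ω, F (U ω, v) ∂μ ∂(μ.map V) :=
        lintegral_congr fun v => lintegral_map (hF.comp measurable_prodMk_right) hU
    _ ≤ ∫⁻ v, G v ∂(μ.map V) := lintegral_mono h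
    _ = _ := lintegral_map hG hV

/-- Extension of a finite path by zero. -/
def extendPath {E : Type*} [Zero E] {T : ℕ} (x : Fin (T + 1) → E) (t : ℕ) : E :=
  if ht : t < T + 1 then x ⟨t, ht⟩ else 0

lemma measurable_extendPath {E : Type*} [Zero E] [MeasurableSpace E] {T : ℕ} :
    Measurable (extendPath : (Fin (T + 1) → E) → ℕ → E) := by
  refine measurable_pi_lambda _ fun t => ?_
  by_cases ht : t < T + 1
  · simp only [extendPath, ht, dite_true]
    exact measurable_pi_apply _
  · simp only [extendPath, ht, dite_false]
    exact measurable_const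

lemma extendPath_of_le {E : Type*} [Zero E] {T t : ℕ} (x : ℕ → E) (ht : t ≤ T) :
    extendPath (fun s : Fin (T + 1) => x s) t = x t := by
  simp [extendPath, Nat.lt_succ_of_le ht]

/-- Replacement of vectors longer than `β` by zero. -/
noncomputable def clip {E : Type*} [NormedAddCommGroup E] (β : ℝ) (x : E) : E :=
  open Classical in if ‖x‖ ≤ β then x else 0

lemma measurable_clip {E : Type*} [NormedAddCommGroup E] [MeasurableSpace E] [BorelSpace E]
    (β : ℝ) : Measurable (clip β : E → E) :=
  Measurable.ite (measurableSet_le measurable_norm measurable_const) measurable_id measurable_const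

lemma norm_clip_le {E : Type*} [NormedAddCommGroup E] {β : ℝ} (hβ : 0 ≤ β) (x : E) :
    ‖clip β x‖ ≤ β := by
  unfold clip
  split_ifs with h
  · exact h
  · simpa using hβ

/-- Clipping changes each input only on a null set, so the moments survive, and independence passes
to functions of the inputs. The bound then holds everywhere, and integrability becomes automatic. -/
lemma BoundedInputs.regular {p T : ℕ} {u : ℕ → Ω → EuclideanSpace ℝ (Fin p)} {β : ℝ}
    [IsProbabilityMeasure μ] (h : BoundedInputs μ T u β) (hβ : 0 ≤ β) :
    RegularInputs μ T
      (fun t ω => extendPath (fun s : Fin (T + 1) => clip β (u s ω)) t) β := by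
  have hae : ∀ t ≤ T, ∀ᵐ ω ∂μ, extendPath (fun s : Fin (T + 1) => clip β (u s ω)) t = u t ω :=
    fun t ht => by
      filter_upwards [h.bounded t ht] with ω hω
      rw [extendPath_of_le (fun s => clip β (u s ω)) ht, clip, if_pos hω]
  refine ⟨fun t => ?_, fun t ω => ?_, ?_, fun t ht i => ?_, fun t ht i j => ?_⟩
  · have h1 : Measurable fun ω => fun s : Fin (T + 1) => clip β (u s ω) :=
      measurable_pi_lambda _ fun s =>
        (measurable_clip β).comp (h.iid.measurable s (Nat.lt_succ_iff.1 s.2))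
    exact measurable_pi_iff.1 (measurable_extendPath.comp h1) t
  · unfold extendPath
    split_ifs with ht
    · exact norm_clip_le hβ _
    · simpa using hβ
  · have : iIndepFun (fun t : Fin (T + 1) => clip β ∘ u t) μ :=
      h.iid.indep.comp (fun _ => clip β) fun _ => measurable_clip β
    convert! this using 2 with t
    ext1 ω
    exact extendPath_of_le (fun s => clip β (u s ω)) (Nat.lt_succ_iff.1 t.2)
  · have h1 : ∫ ω, u t ω i ∂μ = 0 := by
      have h2 : Integrable (u t) μ := Integrable.of_bound
        (h.iid.measurable t ht).aestronglyMeasurable β (h.bounded t ht)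
      have h3 := integral_inner (𝕜 := ℝ) h2 (EuclideanSpace.single i 1)
      rw [h.mean t ht] at h3
      simpa [EuclideanSpace.inner_single_left] using h3
    rw [← h1]
    refine integral_congr_ae ?_
    filter_upwards [hae t ht] with ω hω
    rw [hω]
  · rw [← Matrix.one_apply, ← h.isotropic t ht i j]
    refine integral_congr_ae ?_
    filter_upwards [hae t ht] with ω hω
    rw [hω]

end Reduction

section Congruence

variable {n p L T t : ℕ} {A : Matrix (Fin n) (Fin n) ℝ} {C : Matrix (Fin p) (Fin n) ℝ}

lemma noiseState_congr {w w' : ℕ → EuclideanSpace ℝ (Fin n)} (h : ∀ r ≤ t, w r = w' r) :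
    noiseState A C w t = noiseState A C w' t := by
  unfold noiseState
  congr 1
  exact Finset.sum_congr rfl fun i _ => by rw [h _ (by omega)]

lemma feature_congr {u u' : ℕ → EuclideanSpace ℝ (Fin p)} (h : ∀ r ≤ t, u r = u' r) :
    feature L u t = feature L u' t := by
  unfold feature
  rw [h t le_rfl]
  congr 1
  ext q
  rw [h _ (by omega)]

end Congruence

/-! ### Mean square of the noise–regressor correlation -/

section Main

variable {Ω : Type*} [MeasurableSpace Ω] {μ : Measure Ω}
  {n p L T : ℕ} {A : Matrix (Fin n) (Fin n) ℝ}
  {C : Matrix (Fin p) (Fin n) ℝ} {Sw : Matrix (Fin n) (Fin n) ℝ} {σz ρ β : ℝ}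
  {w : ℕ → Ω → EuclideanSpace ℝ (Fin n)}
  {z : ℕ → Ω → ℝ}

/-- The empirical correlation between the noise and the regressors. -/
noncomputable def noiseCorr (L T : ℕ) (A : Matrix (Fin n) (Fin n) ℝ)
    (C : Matrix (Fin p) (Fin n) ℝ) (u : ℕ → EuclideanSpace ℝ (Fin p))
    (w : ℕ → EuclideanSpace ℝ (Fin n)) (z : ℕ → ℝ) :
    EuclideanSpace ℝ (Fin p × (Fin L × Fin p)) :=
  ∑ t ∈ Finset.Icc (L + 1) T, (z t + ⟪noiseState A C w t, u t⟫) • feature L u t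

lemma RegularInputs.bddMeas_norm_sq_noiseCorr {u : ℕ → Ω → EuclideanSpace ℝ (Fin p)}
    (hu : RegularInputs μ T u β) (w : ℕ → EuclideanSpace ℝ (Fin n)) (z : ℕ → ℝ) :
    BddMeas fun ω => ‖noiseCorr L T A C (fun t => u t ω) w z‖ ^ 2 := by
  simp_rw [EuclideanSpace.real_norm_sq_eq]
  refine BddMeas.sum fun q _ => BddMeas.pow ?_ 2
  have : ∀ ω, noiseCorr L T A C (fun t => u t ω) w z q =
      ∑ t ∈ Finset.Icc (L + 1) T, (z t + ⟪noiseState A C w t, u t ω⟫) *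
        (u t ω q.1 * u (t - 1 - q.2.1) ω q.2.2) := fun ω => by
    simp [noiseCorr, feature]
  simp_rw [this]
  exact BddMeas.sum fun t _ => ((BddMeas.const _).add (hu.bddMeas_inner t _)).mul
    ((hu.bddMeas_coord _ _).mul (hu.bddMeas_coord _ _))

lemma measurable_noiseState (t : ℕ) :
    Measurable fun x : ℕ → EuclideanSpace ℝ (Fin n) => noiseState A C x t := by
  unfold noiseState
  refine (WithLp.measurable_toLp 2 _).comp (measurable_pi_lambda _ fun i => ?_)
  simp only [Finset.sum_apply, Matrix.mulVec, dotProduct]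
  fun_prop

lemma measurable_feature (t : ℕ) :
    Measurable fun x : ℕ → EuclideanSpace ℝ (Fin p) => feature L x t := by
  unfold feature
  refine (WithLp.measurable_toLp 2 _).comp (measurable_pi_lambda _ fun i => ?_)
  fun_prop

lemma measurable_noiseCorr : Measurable fun q : (ℕ → EuclideanSpace ℝ (Fin p)) ×
    ((ℕ → EuclideanSpace ℝ (Fin n)) × (ℕ → ℝ)) => noiseCorr L T A C q.1 q.2.1 q.2.2 := by
  refine Finset.measurable_fun_sum _ fun t _ => ?_
  have h1 : Measurable fun q : (ℕ → EuclideanSpace ℝ (Fin p)) ×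
      ((ℕ → EuclideanSpace ℝ (Fin n)) × (ℕ → ℝ)) => q.1 t :=
    (measurable_pi_apply (X := fun _ : ℕ => EuclideanSpace ℝ (Fin p)) t).comp measurable_fst
  have h2 : Measurable fun q : (ℕ → EuclideanSpace ℝ (Fin p)) ×
      ((ℕ → EuclideanSpace ℝ (Fin n)) × (ℕ → ℝ)) => noiseState A C q.2.1 t :=
    (measurable_noiseState t).comp (measurable_fst.comp measurable_snd)
  have h3 : Measurable fun q : (ℕ → EuclideanSpace ℝ (Fin p)) ×
      ((ℕ → EuclideanSpace ℝ (Fin n)) × (ℕ → ℝ)) => q.2.2 t :=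
    (measurable_pi_apply (X := fun _ : ℕ => ℝ) t).comp (measurable_snd.comp measurable_snd)
  exact (h3.add (h2.inner h1)).smul ((measurable_feature t).comp measurable_fst)

lemma measurable_noiseCorr_extendPath : Measurable fun q : (ℕ → EuclideanSpace ℝ (Fin p)) ×
    ((Fin (T + 1) → EuclideanSpace ℝ (Fin n)) × (Fin (T + 1) → ℝ)) =>
      noiseCorr L T A C q.1 (extendPath q.2.1) (extendPath q.2.2) := by
  have h1 : Measurable (Prod.map (extendPath : (Fin (T + 1) → EuclideanSpace ℝ (Fin n)) → ℕ → _)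
      (extendPath : (Fin (T + 1) → ℝ) → ℕ → ℝ)) :=
    measurable_extendPath.prodMap measurable_extendPath
  have h2 := (measurable_noiseCorr (L := L) (T := T) (A := A) (C := C)).comp
    ((measurable_id (α := ℕ → EuclideanSpace ℝ (Fin p))).prodMap h1)
  simp only [Function.comp_def, Prod.map_fst, Prod.map_snd, id_eq] at h2
  exact h2

lemma noiseCorr_extendPath (u : ℕ → EuclideanSpace ℝ (Fin p)) (w : ℕ → EuclideanSpace ℝ (Fin n))
    (z : ℕ → ℝ) :
    noiseCorr L T A C u (extendPath fun s : Fin (T + 1) => w s)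
      (extendPath fun s : Fin (T + 1) => z s) = noiseCorr L T A C u w z := by
  refine Finset.sum_congr rfl fun t ht => ?_
  have htT := (Finset.mem_Icc.1 ht).2
  rw [extendPath_of_le z htT,
    noiseState_congr fun r hr => extendPath_of_le (T := T) w (hr.trans htT)]

lemma measurable_finitePaths (hw : NoiseAssumption μ T w z Sw σz) : Measurable fun ω =>
    ((fun t : Fin (T + 1) => w t ω), (fun t : Fin (T + 1) => z t ω)) :=
  (measurable_pi_lambda _ fun t : Fin (T + 1) =>
    hw.iid_w.measurable t (Nat.lt_succ_iff.1 t.2)).prodMk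
    (measurable_pi_lambda _ fun t : Fin (T + 1) =>
      hw.iid_z.measurable t (Nat.lt_succ_iff.1 t.2))

lemma measurable_noiseCorr_comp {u : ℕ → Ω → EuclideanSpace ℝ (Fin p)} (hu : ∀ t, Measurable (u t))
    (hw : NoiseAssumption μ T w z Sw σz) : Measurable fun ω =>
      noiseCorr L T A C (fun t => u t ω) (fun t => w t ω) (fun t => z t ω) := by
  have hV := measurable_finitePaths hw
  have h1 : Measurable fun ω => fun t => u t ω := measurable_pi_lambda _ hu
  have h2 := (measurable_noiseCorr_extendPath (L := L) (T := T) (A := A) (C := C)).comp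
    (h1.prodMk hV)
  convert! h2 using 1
  ext1 ω
  exact (noiseCorr_extendPath _ (fun t => w t ω) (fun t => z t ω)).symm

/-- The frozen-noise bound is averaged over the noise, which is independent of the inputs. Finite
paths are extended by zero to match the independence hypothesis. -/
lemma lintegral_noiseCorr_le [IsProbabilityMeasure μ] (hL : 1 ≤ L) (hp : 1 ≤ p) (hLT : L ≤ T)
    (hA : specRadius A < ENNReal.ofReal ρ) (hρ1 : ρ < 1)
    (hw : NoiseAssumption μ T w z Sw σz) {u : ℕ → Ω → EuclideanSpace ℝ (Fin p)}
    (hu : RegularInputs μ T u β)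
    (hind : IndepFun (fun ω t => u t ω)
      (fun ω => ((fun t : Fin (T + 1) => w t ω), (fun t : Fin (T + 1) => z t ω))) μ) :
    ∫⁻ ω, ENNReal.ofReal (‖noiseCorr L T A C (fun t => u t ω) (fun t => w t ω)
      (fun t => z t ω)‖ ^ 2) ∂μ ≤
      ENNReal.ofReal (2 * (p ^ 2 * L * noiseLevel L A C Sw σz ρ β) * ((T : ℝ) - L)) := by
  let F : (ℕ → EuclideanSpace ℝ (Fin p)) ×
      ((Fin (T + 1) → EuclideanSpace ℝ (Fin n)) × (Fin (T + 1) → ℝ)) → ENNReal := fun q =>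
    ENNReal.ofReal (‖noiseCorr L T A C q.1 (extendPath q.2.1) (extendPath q.2.2)‖ ^ 2)
  let G : (Fin (T + 1) → EuclideanSpace ℝ (Fin n)) × (Fin (T + 1) → ℝ) → ENNReal := fun v =>
    ENNReal.ofReal (L * p * ∑ t ∈ Finset.Icc (L + 1) T, (2 * p * extendPath v.2 t ^ 2 +
      2 * β ^ 2 * ‖noiseState A C (extendPath v.1) t‖ ^ 2))
  have hz : ∀ t, Measurable fun v : (Fin (T + 1) → EuclideanSpace ℝ (Fin n)) ×
      (Fin (T + 1) → ℝ) => extendPath v.2 t := fun t =>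
    (measurable_pi_apply t).comp (measurable_extendPath.comp measurable_snd)
  have hh : ∀ t, Measurable fun v : (Fin (T + 1) → EuclideanSpace ℝ (Fin n)) ×
      (Fin (T + 1) → ℝ) => noiseState A C (extendPath v.1) t := fun t =>
    (measurable_noiseState t).comp (measurable_extendPath.comp measurable_fst)
  have hF : Measurable F := by
    have h1 := measurable_noiseCorr_extendPath (L := L) (T := T) (A := A) (C := C)
    exact ENNReal.measurable_ofReal.comp (h1.norm.pow_const 2)
  have hG : Measurable G := by
    refine ENNReal.measurable_ofReal.comp (Measurable.const_mul ?_ _)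
    refine Finset.measurable_fun_sum _ fun t _ => ?_
    exact (((hz t).pow_const 2).const_mul _).add (((hh t).norm.pow_const 2).const_mul _)
  have hFG : ∀ v, ∫⁻ ω, F ((fun t => u t ω), v) ∂μ ≤ G v := fun v => by
    simp only [F]
    rw [← ofReal_integral_eq_lintegral_ofReal (hu.bddMeas_norm_sq_noiseCorr _ _).integrable
      (Filter.Eventually.of_forall fun ω => sq_nonneg _)]
    exact ENNReal.ofReal_le_ofReal (hu.integral_norm_sq_sum_le _ _)
  have key := lintegral_le_of_indepFun hu.measurable_path (measurable_finitePaths hw) hind hF hG hFG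
  have hwext : ∀ ω, ∀ t ≤ T, extendPath (fun s : Fin (T + 1) => w s ω) t = w t ω := fun ω t ht =>
    extendPath_of_le (fun s => w s ω) ht
  have hzext : ∀ ω, ∀ t ≤ T, extendPath (fun s : Fin (T + 1) => z s ω) t = z t ω := fun ω t ht =>
    extendPath_of_le (fun s => z s ω) ht
  have hnsext : ∀ ω, ∀ t ≤ T, noiseState A C (extendPath (fun s : Fin (T + 1) => w s ω)) t =
      noiseState A C (fun r => w r ω) t := fun ω t ht =>
    noiseState_congr fun r hr => hwext ω r (hr.trans ht)
  have hFeq : ∀ ω, F ((fun t => u t ω), ((fun t : Fin (T + 1) => w t ω),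
      (fun t : Fin (T + 1) => z t ω))) = ENNReal.ofReal (‖noiseCorr L T A C (fun t => u t ω)
        (fun t => w t ω) (fun t => z t ω)‖ ^ 2) := fun ω => by
    simp only [F, noiseCorr_extendPath _ (fun t => w t ω) (fun t => z t ω)]
  have hGeq : ∀ ω, G ((fun t : Fin (T + 1) => w t ω), (fun t : Fin (T + 1) => z t ω)) =
      ENNReal.ofReal (L * p * ∑ t ∈ Finset.Icc (L + 1) T, (2 * p * z t ω ^ 2 +
        2 * β ^ 2 * ‖noiseState A C (fun r => w r ω) t‖ ^ 2)) := fun ω => by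
    simp only [G]
    congr 2
    refine Finset.sum_congr rfl fun t ht => ?_
    have htT := (Finset.mem_Icc.1 ht).2
    rw [hzext ω t htT, hnsext ω t htT]
  simp_rw [hFeq, hGeq] at key
  refine key.trans ?_
  have hi1 : ∀ t ∈ Finset.Icc (L + 1) T, Integrable (fun ω => 2 * (p : ℝ) * z t ω ^ 2) μ :=
    fun t ht => (hw.memLp_z t (Finset.mem_Icc.1 ht).2).integrable_sq.const_mul _
  have hi2 : ∀ t ∈ Finset.Icc (L + 1) T,
      Integrable (fun ω => 2 * β ^ 2 * ‖noiseState A C (fun r => w r ω) t‖ ^ 2) μ :=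
    fun t ht => (hw.integrable_noiseState (Finset.mem_Icc.1 ht).2).const_mul _
  have hi12 : ∀ t ∈ Finset.Icc (L + 1) T, Integrable (fun ω => 2 * (p : ℝ) * z t ω ^ 2 +
      2 * β ^ 2 * ‖noiseState A C (fun r => w r ω) t‖ ^ 2) μ :=
    fun t ht => (hi1 t ht).add (hi2 t ht)
  have hi3 : Integrable (fun ω => (L : ℝ) * p * ∑ t ∈ Finset.Icc (L + 1) T, (2 * (p : ℝ) * z t ω ^ 2 +
        2 * β ^ 2 * ‖noiseState A C (fun r => w r ω) t‖ ^ 2)) μ :=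
    (integrable_finsetSum _ hi12).const_mul _
  rw [← ofReal_integral_eq_lintegral_ofReal hi3
    (Filter.Eventually.of_forall fun ω => by
      have : ∀ t, (0 : ℝ) ≤ 2 * p * z t ω ^ 2 +
          2 * β ^ 2 * ‖noiseState A C (fun r => w r ω) t‖ ^ 2 := fun t => by positivity
      exact mul_nonneg (by positivity) (Finset.sum_nonneg fun t _ => this t))]
  refine ENNReal.ofReal_le_ofReal ?_
  rw [integral_const_mul, integral_finsetSum _ hi12]
  have hL' : (1 : ℝ) ≤ L := by exact_mod_cast hL
  have hp' : (1 : ℝ) ≤ p := by exact_mod_cast hp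
  have hρ := rho_pos hA
  have hφ := transient_nonneg hA
  have hsw : 0 ≤ sigmaWSq L A C Sw ρ := by
    have := div_nonneg (mul_nonneg hφ (pow_nonneg hρ.le L)) (by linarith : 0 ≤ 1 - ρ)
    exact mul_nonneg (mul_nonneg (specNorm_nonneg _) (sq_nonneg _)) (by linarith)
  have hse : 0 ≤ sigmaESq L A C Sw ρ :=
    mul_nonneg (mul_nonneg (specNorm_nonneg _) (sq_nonneg _))
      (div_nonneg hφ (by linarith))
  have hterm : ∀ t ∈ Finset.Icc (L + 1) T,
      ∫ ω, (2 * (p : ℝ) * z t ω ^ 2 + 2 * β ^ 2 * ‖noiseState A C (fun r => w r ω) t‖ ^ 2) ∂μ ≤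
      2 * p * noiseLevel L A C Sw σz ρ β := fun t ht => by
    obtain ⟨ht1, ht2⟩ := Finset.mem_Icc.1 ht
    rw [integral_add (hi1 t ht) (hi2 t ht), integral_const_mul, integral_const_mul,
      hw.var_z t ht2]
    have h1 := hw.integral_noiseState_le (C := C) ht2 (by omega : L ≤ t) hA hρ1
    have h2 := mul_le_mul_of_nonneg_left h1 (by positivity : 0 ≤ 2 * β ^ 2)
    -- The mean of one term is 2pσ_z² + 2β²(σ_w² + pσ_e²); p, L ≥ 1 bring it below 2pΞ.
    have h3 : sigmaWSq L A C Sw ρ ≤ p * (sigmaWSq L A C Sw ρ * L) := by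
      have := le_mul_of_one_le_right hsw hL'
      exact this.trans (le_mul_of_one_le_left (mul_nonneg hsw (by positivity)) hp')
    have h4 := mul_le_mul_of_nonneg_left h3 (by positivity : 0 ≤ 2 * β ^ 2)
    unfold noiseLevel
    linarith
  have hcard : ((Finset.Icc (L + 1) T).card : ℝ) = (T : ℝ) - L := by
    rw [Nat.card_Icc, Nat.cast_sub (by omega)]
    push_cast
    ring
  refine (mul_le_mul_of_nonneg_left (Finset.sum_le_sum hterm) (by positivity)).trans (le_of_eq ?_)
  rw [Finset.sum_const, nsmul_eq_mul, hcard]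
  ring

end Main

end BilinearObs

/-! ### Assembling the three estimates -/

namespace BilinearObs

open scoped RealInnerProductSpace

/-- A nonzero B or C forces the identity A⁰ to have nonzero norm. Positivity lets the logarithm in
the condition on L be inverted. -/
lemma transient_pos {n p : ℕ} {A : Matrix (Fin n) (Fin n) ℝ} {B : Matrix (Fin n) (Fin p) ℝ}
    {C : Matrix (Fin p) (Fin n) ℝ} {ρ : ℝ} (h : specRadius A < ENNReal.ofReal ρ)
    (hK : 0 < max (specNorm B) (specNorm C)) : 0 < transient A ρ := by
  have h1 := specNorm_pow_le h 0
  rw [pow_zero, pow_zero, mul_one] at h1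
  refine lt_of_lt_of_le (lt_of_le_of_ne (specNorm_nonneg _) fun h0 => ?_) h1
  have hB := specNorm_mul_le (1 : Matrix (Fin n) (Fin n) ℝ) B
  have hC := specNorm_mul_le C (1 : Matrix (Fin n) (Fin n) ℝ)
  rw [← h0, Matrix.one_mul, zero_mul] at hB
  rw [← h0, Matrix.mul_one, mul_zero] at hC
  exact (max_le hB hC).not_gt hK

lemma tailBias_sq_le {n p L T t : ℕ} {A : Matrix (Fin n) (Fin n) ℝ} {B : Matrix (Fin n) (Fin p) ℝ}
    {C : Matrix (Fin p) (Fin n) ℝ} {ρ β K δ N D : ℝ} (hA : specRadius A < ENNReal.ofReal ρ)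
    (hρ1 : ρ < 1) (hK : K = max (specNorm B) (specNorm C)) (hβ : 0 < β) (hδ : 0 < δ) (hN : 0 < N)
    (hD : 0 < D)
    (hlog : 0 < K → 1 / Real.log ρ⁻¹ * (1 / 2 * Real.log (N * δ / D) +
      Real.log (2 * β ^ 2 * K ^ 2 * transient A ρ / (1 - ρ))) ≤ L)
    {u : ℕ → EuclideanSpace ℝ (Fin p)} (hu : ∀ r ≤ T, ‖u r‖ ≤ β) (ht : t ≤ T) :
    tailBias L A B C u t ^ 2 ≤ D / (4 * (δ * N)) := by
  have hb := abs_tailBias_le (L := L) (t := t) (K := K) hA hρ1 (hK ▸ le_max_left _ _)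
    (hK ▸ le_max_right _ _) fun r hr => hu r (hr.trans ht)
  have hK0 : 0 ≤ K := by
    rw [hK]
    exact (specNorm_nonneg B).trans (le_max_left _ _)
  have hsq : tailBias L A B C u t ^ 2 ≤ (β ^ 2 * K ^ 2 * transient A ρ / (1 - ρ) * ρ ^ L) ^ 2 := by
    rw [← sq_abs]
    gcongr
  refine hsq.trans ?_
  -- For K = 0 the bound on the bias is 0, which is why the condition on L may be void there.
  rcases hK0.eq_or_lt with h0 | hKpos
  · rw [← h0]
    simp only [ne_eq, OfNat.ofNat_ne_zero, not_false_eq_true, zero_pow, mul_zero, zero_mul, zero_div]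
    positivity
  · have hφ : 0 < transient A ρ := transient_pos (B := B) (C := C) hA (hK ▸ hKpos)
    have h1 : 0 < 1 - ρ := by linarith
    exact bias_sq_le_of_log_le (rho_pos hA) hρ1 hN hδ hD (by positivity) (by ring) (hlog hKpos)

/-- On the event that the regressors are exciting and the noise correlation is small, every least
squares solution is accurate. -/
lemma frobNorm_sub_markov_le {n p L T : ℕ} {A : Matrix (Fin n) (Fin n) ℝ}
    {B : Matrix (Fin n) (Fin p) ℝ} {C : Matrix (Fin p) (Fin n) ℝ} {δ D : ℝ}
    {u : ℕ → EuclideanSpace ℝ (Fin p)} {w : ℕ → EuclideanSpace ℝ (Fin n)} {z : ℕ → ℝ}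
    {Ghat : Matrix (Fin p) (Fin L × Fin p) ℝ} (hδ : 0 < δ) (hN : 0 < (T : ℝ) - L)
    (hlow : ∀ v : EuclideanSpace ℝ (Fin p × (Fin L × Fin p)), ((T : ℝ) - L) / 4 * ‖v‖ ^ 2 ≤
      ∑ t ∈ Finset.Icc (L + 1) T, ⟪v, feature L u t⟫ ^ 2)
    (hcorr : ‖noiseCorr L T A C u w z‖ ^ 2 ≤ 4 * D * ((T : ℝ) - L) / δ)
    (hbias : ∀ t ≤ T, tailBias L A B C u t ^ 2 ≤ D / (4 * (δ * ((T : ℝ) - L))))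
    (hG : IsLeastSquares L T u (output A B C u w z) Ghat) :
    frobNorm (Ghat - markov L A B C) ≤ 33 * √(D / (δ * ((T : ℝ) - L))) := by
  set N : ℝ := (T : ℝ) - L with hNdef
  have hLT : L ≤ T := by
    have : (L : ℝ) < T := by linarith
    exact_mod_cast this.le
  set J := Finset.Icc (L + 1) T with hJ
  have hcard : (J.card : ℝ) = N := by
    rw [hJ, Nat.card_Icc, hNdef, Nat.cast_sub (by omega)]
    push_cast
    ring
  have hopt : ∑ t ∈ J, (z t + ⟪noiseState A C w t, u t⟫ + tailBias L A B C u t -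
      ⟪vecMat (Ghat - markov L A B C), feature L u t⟫) ^ 2 ≤
      ∑ t ∈ J, (z t + ⟪noiseState A C w t, u t⟫ + tailBias L A B C u t) ^ 2 := by
    have h1 := hG (markov L A B C)
    unfold lsLoss at h1
    have h2 := le_of_mul_le_mul_left h1 (by positivity : 0 < 1 / (2 * N))
    refine le_trans (le_of_eq ?_) (h2.trans (le_of_eq ?_))
    · refine Finset.sum_congr rfl fun t ht => ?_
      rw [output_eq u w z (by have := Finset.mem_Icc.1 ht; omega : L ≤ t),
        dotProduct_mulVec_lagged, vecMat_sub, inner_sub_left]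
      ring
    · refine Finset.sum_congr rfl fun t ht => ?_
      rw [output_eq u w z (by have := Finset.mem_Icc.1 ht; omega : L ≤ t),
        dotProduct_mulVec_lagged]
      ring
  have hb : ∑ t ∈ J, tailBias L A B C u t ^ 2 ≤ N * (D / (4 * (δ * N))) := by
    refine (Finset.sum_le_sum fun t ht => hbias t (Finset.mem_Icc.1 ht).2).trans (le_of_eq ?_)
    rw [Finset.sum_const, nsmul_eq_mul, hcard]
  have h1 := norm_sq_le_of_leastSquares J (feature L u) _ _ _ hN (hlow _) hopt hb
  have h2 : ‖noiseCorr L T A C u w z‖ ^ 2 / N ^ 2 ≤ 4 * D * N / δ / N ^ 2 := by gcongr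
  -- The sign of D is not assumed; it is read off from the bias bound at t = 0.
  have hD : 0 ≤ D / (δ * N) := by
    have := (sq_nonneg _).trans (hbias 0 (Nat.zero_le _))
    have h3 : D / (4 * (δ * N)) = D / (δ * N) / 4 := by field_simp
    linarith
  rw [← norm_vecMat]
  -- In units of D/(δN): 256 · 4 + 32/4 = 1032 ≤ 33².
  refine le_of_sq_le_sq ?_ (by positivity)
  rw [mul_pow, Real.sq_sqrt hD]
  refine h1.trans ?_
  have h3 : 4 * D * N / δ / N ^ 2 = 4 * (D / (δ * N)) := by field_simp
  have h4 : D / (4 * (δ * N)) = D / (δ * N) / 4 := by field_simp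
  rw [h3] at h2
  rw [h4]
  unfold noiseCorr at h2
  linarith

end BilinearObs

theorem mainTheorem2 :
    ∃ c₁ c₂ : ℝ, 0 < c₁ ∧ 0 < c₂ ∧
      ∀ (Ω : Type*) [MeasurableSpace Ω] (μ : Measure Ω) [IsProbabilityMeasure μ]
        (n p L T : ℕ)
        (A : Matrix (Fin n) (Fin n) ℝ) (B : Matrix (Fin n) (Fin p) ℝ)
        (C : Matrix (Fin p) (Fin n) ℝ) (Sw : Matrix (Fin n) (Fin n) ℝ)
        (σz ρ β δ K : ℝ)
        (u : ℕ → Ω → EuclideanSpace ℝ (Fin p)) (w : ℕ → Ω → EuclideanSpace ℝ (Fin n))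
        (z : ℕ → Ω → ℝ),
        1 ≤ L →
        0 < δ → δ < 1 →
        0 < β →
        BilinearObs.specRadius A < 1 →
        BilinearObs.specRadius A < ENNReal.ofReal ρ → ρ < 1 →
        BilinearObs.NoiseAssumption μ T w z Sw σz →
        BilinearObs.BoundedInputs μ T u β →
        BilinearObs.IndepProcesses μ T u w z →
        K = max (BilinearObs.specNorm B) (BilinearObs.specNorm C) →
        0 < BilinearObs.noiseLevel L A C Sw σz ρ β →
        c₁ * (β ^ 4 * L * (L + 1) * (Real.log (2 * (L + 1) / δ) + p ^ 2 * L)) ≤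
          (T : ℝ) - (L : ℝ) →
        (0 < K →
          1 / Real.log ρ⁻¹ *
            (1 / 2 * Real.log (((T : ℝ) - (L : ℝ)) * δ /
                (p ^ 2 * L * BilinearObs.noiseLevel L A C Sw σz ρ β)) +
              Real.log (2 * β ^ 2 * K ^ 2 * BilinearObs.transient A ρ / (1 - ρ))) ≤ (L : ℝ)) →
        1 - δ ≤ μ.real {ω | ∀ Ghat : Matrix (Fin p) (Fin L × Fin p) ℝ,
          BilinearObs.IsLeastSquares L T (fun t => u t ω)
              (BilinearObs.output A B C (fun t => u t ω) (fun t => w t ω) (fun t => z t ω)) Ghat →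
            BilinearObs.frobNorm (Ghat - BilinearObs.markov L A B C) ≤
              c₂ * Real.sqrt (p ^ 2 * L * BilinearObs.noiseLevel L A C Sw σz ρ β /
                (δ * ((T : ℝ) - (L : ℝ))))} := by
  refine ⟨640, 33, by norm_num, by norm_num, ?_⟩
  intro Ω _ μ _ n p L T A B C Sw σz ρ β δ K u w z hL hδ hδ1 hβ _ hA hρ1 hw hu hind hK hΞ hT hlog
  have hL' : (1 : ℝ) ≤ L := by exact_mod_cast hL
  set D : ℝ := p ^ 2 * L * BilinearObs.noiseLevel L A C Sw σz ρ β with hDdef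
  set good := {ω | ∀ Ghat : Matrix (Fin p) (Fin L × Fin p) ℝ,
    BilinearObs.IsLeastSquares L T (fun t => u t ω)
      (BilinearObs.output A B C (fun t => u t ω) (fun t => w t ω) (fun t => z t ω)) Ghat →
    BilinearObs.frobNorm (Ghat - BilinearObs.markov L A B C) ≤
      33 * Real.sqrt (D / (δ * ((T : ℝ) - (L : ℝ))))} with hgood
  -- For p = 0 the matrices are empty and the error is 0; the probabilistic estimates need p ≥ 1.
  rcases Nat.eq_zero_or_pos p with hp0 | hp
  · subst hp0
    have huniv : good = Set.univ := Set.eq_univ_of_forall fun ω Ghat _ => by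
      have h0 : BilinearObs.frobNorm (Ghat - BilinearObs.markov L A B C) ^ 2 = 0 := by
        rw [BilinearObs.frobNorm_sq]
        simp
      rw [pow_eq_zero_iff two_ne_zero] at h0
      rw [h0]
      positivity
    rw [huniv]
    simp [hδ.le]
  have hp' : (1 : ℝ) ≤ p := by exact_mod_cast hp
  have hDpos : 0 < D := by positivity
  have hN : 0 < (T : ℝ) - L := by
    refine lt_of_lt_of_le ?_ hT
    have h1 : 0 ≤ Real.log (2 * ((L : ℝ) + 1) / δ) := by
      refine Real.log_nonneg ?_
      rw [one_le_div hδ]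
      linarith
    positivity
  have hLT : L ≤ T := by
    have : (L : ℝ) < T := by linarith
    exact_mod_cast this.le
  set v : ℕ → Ω → EuclideanSpace ℝ (Fin p) := fun t ω =>
    BilinearObs.extendPath (fun s : Fin (T + 1) => BilinearObs.clip β (u s ω)) t with hv
  have hreg : BilinearObs.RegularInputs μ T v β := hu.regular hβ.le
  have hae : ∀ᵐ ω ∂μ, ∀ t ≤ T, ‖u t ω‖ ≤ β ∧ v t ω = u t ω := by
    rw [MeasureTheory.ae_all_iff]
    intro t
    by_cases ht : t ≤ T
    · filter_upwards [hu.bounded t ht] with ω hω _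
      refine ⟨hω, ?_⟩
      simp only [hv]
      rw [BilinearObs.extendPath_of_le (fun s => BilinearObs.clip β (u s ω)) ht,
        BilinearObs.clip, if_pos hω]
    · exact Filter.Eventually.of_forall fun ω h => absurd h ht
  have hvind : IndepFun (fun ω t => v t ω)
      (fun ω => ((fun t : Fin (T + 1) => w t ω), (fun t : Fin (T + 1) => z t ω))) μ := by
    refine hind.input_noise.comp (φ := fun x : Fin (T + 1) → EuclideanSpace ℝ (Fin p) =>
      BilinearObs.extendPath fun s => BilinearObs.clip β (x s)) (ψ := id) ?_ measurable_id
    exact BilinearObs.measurable_extendPath.comp (measurable_pi_lambda _ fun s =>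
      (BilinearObs.measurable_clip β).comp (measurable_pi_apply s))
  have hbad₁ := hreg.measure_not_excited_le hL hp hδ hδ1 hT
  set bad₁ := {ω | ¬ ∀ x : EuclideanSpace ℝ (Fin p × (Fin L × Fin p)),
    ((T : ℝ) - L) / 4 * ‖x‖ ^ 2 ≤ ∑ t ∈ Finset.Icc (L + 1) T,
      inner ℝ x (BilinearObs.feature L (fun r => v r ω) t) ^ 2} with hbad₁def
  -- Twice the mean bound 2DN divided by δ, so that Markov's inequality leaves failure probability
  -- δ/2.
  set τ : ℝ := 4 * D * ((T : ℝ) - L) / δ with hτ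
  have hτpos : 0 < τ := by positivity
  set S : Ω → ℝ := fun ω => ‖BilinearObs.noiseCorr L T A C (fun t => v t ω) (fun t => w t ω)
    (fun t => z t ω)‖ ^ 2 with hS
  have hbad₂ : μ {ω | τ < S ω} ≤ ENNReal.ofReal (δ / 2) := by
    have h1 := BilinearObs.lintegral_noiseCorr_le (C := C) hL hp hLT hA hρ1 hw hreg hvind
    have h2 : μ {ω | τ < S ω} ≤ μ {ω | ENNReal.ofReal τ ≤ ENNReal.ofReal (S ω)} :=
      measure_mono fun ω hω => ENNReal.ofReal_le_ofReal (le_of_lt hω)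
    have h3 := ENNReal.ofReal_pos.2 hτpos
    have hmarkov : ENNReal.ofReal τ * μ {ω | ENNReal.ofReal τ ≤ ENNReal.ofReal (S ω)} ≤
        ∫⁻ ω, ENNReal.ofReal (S ω) ∂μ := mul_meas_ge_le_lintegral₀
          (ENNReal.measurable_ofReal.comp ((BilinearObs.measurable_noiseCorr_comp
            hreg.meas hw).norm.pow_const 2)).aemeasurable _
    refine h2.trans ?_
    have h4 : ENNReal.ofReal (δ / 2) = ENNReal.ofReal (2 * D * ((T : ℝ) - L)) /
        ENNReal.ofReal τ := by
      rw [← ENNReal.ofReal_div_of_pos hτpos]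
      congr 1
      rw [hτ]
      field_simp
      norm_num
    rw [h4, ENNReal.le_div_iff_mul_le (Or.inl h3.ne') (Or.inl ENNReal.ofReal_ne_top), mul_comm]
    exact hmarkov.trans h1
  -- Covering the whole space and using subadditivity avoids any measurability of the good event,
  -- which quantifies over all minimisers.
  have hsub : (Set.univ : Set Ω) ⊆ good ∪ (bad₁ ∪ ({ω | τ < S ω} ∪
      {ω | ¬ ∀ t ≤ T, ‖u t ω‖ ≤ β ∧ v t ω = u t ω})) := fun ω _ => by
    by_contra hcon
    simp only [Set.mem_union, not_or] at hcon
    obtain ⟨hng, h1, h2, h3⟩ := hcon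
    simp only [hbad₁def, Set.mem_ofPred_eq, not_not, not_lt] at h1 h2 h3
    refine hng fun Ghat hG => ?_
    have hfeat : ∀ t ∈ Finset.Icc (L + 1) T, BilinearObs.feature L (fun r => v r ω) t =
        BilinearObs.feature L (fun r => u r ω) t := fun t ht =>
      BilinearObs.feature_congr fun r hr => (h3 r (hr.trans (Finset.mem_Icc.1 ht).2)).2
    refine BilinearObs.frobNorm_sub_markov_le hδ hN (fun x => (h1 x).trans (le_of_eq ?_)) ?_ ?_ hG
    · exact Finset.sum_congr rfl fun t ht => by rw [hfeat t ht]
    · refine le_trans (le_of_eq ?_) h2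
      simp only [hS, BilinearObs.noiseCorr]
      congr 2
      refine Finset.sum_congr rfl fun t ht => ?_
      rw [hfeat t ht, (h3 t (Finset.mem_Icc.1 ht).2).2]
    · exact fun t ht => BilinearObs.tailBias_sq_le hA hρ1 hK hβ hδ hN hDpos hlog
        (fun r hr => (h3 r hr).1) ht
  have hfinal : 1 ≤ μ good + ENNReal.ofReal δ := by
    calc (1 : ENNReal) = μ Set.univ := measure_univ.symm
      _ ≤ _ := measure_mono hsub
      _ ≤ μ good + (ENNReal.ofReal (δ / 2) + (ENNReal.ofReal (δ / 2) + 0)) := by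
        refine (measure_union_le _ _).trans (add_le_add le_rfl ((measure_union_le _ _).trans
          (add_le_add hbad₁ ((measure_union_le _ _).trans (add_le_add hbad₂ ?_)))))
        exact le_of_eq (ae_iff.1 hae)
      _ = μ good + ENNReal.ofReal δ := by
        rw [add_zero, ← ENNReal.ofReal_add (by positivity) (by positivity), add_halves]
  rw [← ofReal_measureReal (measure_ne_top μ good), ← ENNReal.ofReal_add measureReal_nonneg hδ.le,
    ENNReal.one_le_ofReal] at hfinal
  linarith
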